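/- **Setting.** All random variables are discrete (countable alphabets). Let $m\ge 2$ and let $G=(\mathcal M,\mathcal E)$ be a tree on the terminals $\mathcal M=[m]$. A Tree-PIN on $G$ consists of mutually independent random variables $V_{ij}=V_{ji}$, one for each edge $e_{ij}\in\mathcal E$. Terminal $j$ observes $X_j=(V_{ji} : i\in\Gamma(j))$, where $\Gamma(j)$ is the set of neighbours of $j$. The adversary observes $Z=(Z_{ij})_{e_{ij}\in\mathcal E}$ with $P_{Z|X_{\mathcal M}}=\prod_{e_{ij}\in\mathcal E}P_{Z_{ij}|V_{ij}}$. For each $n$, the terminals and the adversary see $n$ IID samples $X_j^n$, $Z^n$. Entropies are in bits, and may be $+\infty$. A key $K$ with finite alphabet $\mathcal K$ is an $(\epsilon,\sigma)$-secret key for a set $\mathcal A$ of terminals, with public communication $\mathbf F$ and local outputs $K_j$, if $\Pr[K_j=K]\ge 1-\epsilon$ for all $j\in\mathcal A$ and $\mathbf{SD}\big((K,\mathbf F,Z^n);(U,\mathbf F,Z^n)\big)\le\sigma$, where $\mathbf{SD}$ is statistical distance and $U$ is uniform on $\mathcal K$ and independent of $(\mathbf F,Z^n)$. A protocol is non-interactive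 if the broadcasts of each terminal $j$ are functions of $X_j^n$ only. **Protocol.** $G$ has a leaf; fix any leaf and label it $1$, and its neighbour $2$. The two endpoints of each edge $e_{ij}$ extract a common pairwise key $S_{ij}=S_{ji}=\mathrm{Ext}_{ij}(V_{ij}^n)$, a bit string of length at least $\lambda$, possibly with public communication $Q_{ij}$ sent by $i$ and $j$ as functions of $V_{ij}^n$. They truncate it to its first $\lambda$ bits $S'_{ij}$. For a terminal $j$ let $j^*\in\Gamma(j)$ be the neighbour closest to node $1$; terminal $j$ broadcasts $F_{ji}=S'_{jj^*}\oplus S'_{ji}$ for every $i\in\Gamma(j)\setminus\{j^*\}$. The overall communication is $\mathbf F=(F,Q)$. Terminals $1$ and $2$ output $K_1=K_2=S'_{12}$. Every other terminal $j$ outputs $K_j=S'_{jj^*}\oplus\bigoplus F_{ab}$, the sum being over the edges of the path from $j$ to $2$, where $b$ is the endpoint of the edge farther from $2$. The global key is $K=S'_{12}$. **Lemma (achievability).** 1. For every $n$, every $\lambda$ and every choice of extractors and pairwise communications as above: if each $S_{ij}$ is an $(\epsilon,\sigma)$-secret key for $\{i,j\}$ with public communication $Q_{ij}$ against $Z^n$,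 then the global key $K$ of this non-interactive protocol is a $(|\mathcal E|\epsilon,\,2|\mathcal E|\sigma)$-secret key for all terminals, with public communication $\mathbf F$ against $Z^n$. 2. There are extractors, pairwise communications and lengths $\lambda_n$, for all $n$, and positive $\epsilon_n,\sigma_n$ with $\lim_{n\to\infty}(\epsilon_n+\sigma_n)=0$, such that for every $n$ all the $S_{ij}$ are $(\epsilon_n,\sigma_n)$-secret keys, the global key, of length $\lambda_n$, is an $(|\mathcal E|\epsilon_n,\,2|\mathcal E|\sigma_n)$-secret key for all terminals, and the asymptotic key rate is $$\liminf_{n\to\infty}\frac{\lambda_n}{n}=\min_{e_{ij}\in\mathcal E}H(V_{ij}\mid Z).$$ -/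

import Mathlib

open MeasureTheory Filter Topology
open scoped ENNReal

noncomputable section

/-! ## Information measures of discrete random variables -/

/-- The probability mass function of the random variable `X` on the probability space `(Ω, μ)`. -/
def massFn {Ω α : Type*} [MeasurableSpace Ω] (μ : Measure Ω) (X : Ω → α) (a : α) : ℝ :=
  μ.real {ω | X ω = a}

/-- Statistical distance of two probability mass functions. -/
def statDist {α : Type*} (p q : α → ℝ) : ℝ :=
  (1 / 2) * ∑' a, |p a - q a|

/-- Conditional Shannon entropy `H(X | Y)` in bits, for discrete `X` and `Y`, with values in
`[0, ∞]`: the sum over `(x, y)` of the nonnegative terms `p(x,y) log₂ (p(y) / p(x,y))`. -/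
def condEntropy {Ω α β : Type*} [MeasurableSpace Ω] (μ : Measure Ω) (X : Ω → α) (Y : Ω → β) :
    ℝ≥0∞ :=
  ∑' w : α × β, ENNReal.ofReal
    (massFn μ (fun ω => (X ω, Y ω)) w *
      Real.logb 2 (massFn μ Y w.2 / massFn μ (fun ω => (X ω, Y ω)) w))

/-- `K` is an `(ε, σ)`-secret key for the terminals in `A`, who compute the values `out j`, when
the public communication is `F` and the adversary observes `Z`:
every `out j` with `j ∈ A` equals `K` with probability at least `1 - ε`, and
`SD((K, F, Z); (U, F, Z)) ≤ σ` where `U` is uniform on the key alphabet and independent of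
`(F, Z)`. -/
def IsSecretKey {Ω ι κ Φ ζ : Type*} [MeasurableSpace Ω] (μ : Measure Ω) [Fintype κ]
    (A : Set ι) (out : ι → Ω → κ) (K : Ω → κ) (F : Ω → Φ) (Z : Ω → ζ) (ε σ : ℝ) : Prop :=
  (∀ j ∈ A, 1 - ε ≤ μ.real {ω | out j ω = K ω}) ∧
  statDist (massFn μ (fun ω => (K ω, F ω, Z ω)))
    (fun w : κ × Φ × ζ =>
      (Fintype.card κ : ℝ)⁻¹ * massFn μ (fun ω => (F ω, Z ω)) w.2) ≤ σ

/-- Bit strings of length `ℓ`; addition is bitwise XOR. -/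
abbrev Bits (ℓ : ℕ) : Type := Fin ℓ → ZMod 2

/-- The first `L` bits of a bit string. -/
def truncBits {ℓ L : ℕ} (h : L ≤ ℓ) (s : Bits ℓ) : Bits L := fun i => s (Fin.castLE h i)

/-! ## The source -/

/-- A wiretapped pairwise independent network on the graph `G`, given by its distribution: an edge
`e = {i, j}` carries the variable `V_e = V_ij = V_ji` with law `law e`, the `V_e` are mutually
independent, and the adversary sees every `V_e` through its own channel `chan e`, that is
`P_{Z|X} = ∏ P_{Z_e | V_e}`. -/
structure PIN {m : ℕ} (G : SimpleGraph (Fin m)) (𝒱 𝒵 : G.edgeSet → Type*) where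
  law : ∀ e, PMF (𝒱 e)
  chan : ∀ e, 𝒱 e → PMF (𝒵 e)

namespace PIN

variable {m : ℕ} {G : SimpleGraph (Fin m)} {𝒱 𝒵 : G.edgeSet → Type*}

/-- The joint law of `(V_e, Z_e)`. -/
def edgeLaw (S : PIN G 𝒱 𝒵) (e : G.edgeSet) : PMF (𝒱 e × 𝒵 e) :=
  (S.law e).bind fun v => (S.chan e v).map fun z => (v, z)

/-- The sample space of `n` observations of all variables `(V_e, Z_e)`. -/
abbrev Sample (𝒱 𝒵 : G.edgeSet → Type*) (n : ℕ) : Type _ := Fin n → ∀ e, 𝒱 e × 𝒵 e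

section Measure

variable [Fintype G.edgeSet] [∀ e, MeasurableSpace (𝒱 e)] [∀ e, MeasurableSpace (𝒵 e)]

/-- The joint law of all the variables `(V_e, Z_e)`. -/
def joint (S : PIN G 𝒱 𝒵) : Measure (∀ e, 𝒱 e × 𝒵 e) :=
  Measure.pi fun e => (S.edgeLaw e).toMeasure

/-- The law of `n` IID samples. -/
def iid (S : PIN G 𝒱 𝒵) (n : ℕ) : Measure (Sample 𝒱 𝒵 n) :=
  Measure.pi fun _ => S.joint

/-- `H(V_e | Z)`, where `Z` is the whole observation of the adversary. -/
def edgeEntropy (S : PIN G 𝒱 𝒵) (e : G.edgeSet) : ℝ≥0∞ :=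
  condEntropy S.joint (fun ω => (ω e).1) (fun ω e' => (ω e').2)

end Measure

/-- The `n`-sample observation `X_j ^ n` of terminal `j`, where `X_j = (V_e | e ∋ j)`. -/
abbrev Obs (𝒱 : G.edgeSet → Type*) (n : ℕ) (j : Fin m) : Type _ :=
  Fin n → ∀ e : {e : G.edgeSet // j ∈ (e : Sym2 (Fin m))}, 𝒱 e.1

/-- The random variable `X_j ^ n`. -/
def obs {n : ℕ} (ω : Sample 𝒱 𝒵 n) (j : Fin m) : Obs 𝒱 n j := fun t e => (ω t e.1).1

/-- The random variable `V_e ^ n`. -/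
def edgeVar {n : ℕ} (ω : Sample 𝒱 𝒵 n) (e : G.edgeSet) : Fin n → 𝒱 e := fun t => (ω t e).1

/-- The observation `Z ^ n` of the adversary. -/
def eve {n : ℕ} (ω : Sample 𝒱 𝒵 n) : Fin n → ∀ e, 𝒵 e := fun t e => (ω t e).2

end PIN

/-! ## Protocols -/

/-- A non-interactive secret key agreement protocol among `m` terminals with observations in
`X j` and key alphabet `κ`: the broadcast of terminal `j` depends on its own observation only, and
its key is computed from its own observation and all the broadcasts. -/
structure NonInteractiveProtocol {m : ℕ} (X : Fin m → Type*) (κ : Type) where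
  Msg : Fin m → Type
  finite_msg : ∀ j, Finite (Msg j)
  send : ∀ j, X j → Msg j
  key : ∀ j, X j → (∀ i, Msg i) → κ

namespace NonInteractiveProtocol

variable {m : ℕ} {X : Fin m → Type*} {κ : Type}

/-- The overall public communication. -/
def transcript (P : NonInteractiveProtocol X κ) (x : ∀ j, X j) : ∀ j, P.Msg j :=
  fun j => P.send j (x j)

/-- The key computed by terminal `j`. -/
def output (P : NonInteractiveProtocol X κ) (j : Fin m) (x : ∀ j, X j) : κ :=
  P.key j (x j) (P.transcript x)

end NonInteractiveProtocol

/-- Pairwise key extraction from `n` samples along all the edges: both endpoints of the edge `e`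
compute the pairwise key `S_e = ext e (V_e ^ n)`, of `len e` bits. Each endpoint `j` of `e` may
broadcast a message `comm e j (V_e ^ n)`; together these form the public communication `Q_e`
used for `S_e`. -/
structure PairwiseKeys {m : ℕ} {G : SimpleGraph (Fin m)} (𝒱 : G.edgeSet → Type*) (n : ℕ) where
  len : G.edgeSet → ℕ
  ext : ∀ e, (Fin n → 𝒱 e) → Bits (len e)
  Comm : G.edgeSet → Type
  finite_comm : ∀ e, Finite (Comm e)
  comm : ∀ e : G.edgeSet, {j // j ∈ (e : Sym2 (Fin m))} → (Fin n → 𝒱 e) → Comm e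

/-- The edge `{r, s}` is a pendant edge with leaf `r`: the node `s` is the only neighbour of `r`. -/
def IsPendant {m : ℕ} (G : SimpleGraph (Fin m)) (r s : Fin m) : Prop :=
  ∀ i, G.Adj r i ↔ i = s

open Classical in
/-- The neighbour `j*` of `j` that is closest to `r`. -/
def towards {m : ℕ} (G : SimpleGraph (Fin m)) (r j : Fin m) : Fin m :=
  if h : ∃ p, G.Adj j p ∧ ∀ i, G.Adj j i → i ≠ p → G.dist r p < G.dist r i then h.choose else j

/-- The path from `j` to `s` in a tree. -/
def treePath {m : ℕ} {G : SimpleGraph (Fin m)} (hG : G.IsTree) (j s : Fin m) : G.Walk j s :=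
  (hG.existsUnique_path j s).choose

namespace PairwiseKeys

variable {m : ℕ} {G : SimpleGraph (Fin m)} {𝒱 𝒵 : G.edgeSet → Type*} {n : ℕ}

/-- The pairwise key `S_e` is an `(ε, σ)`-secret key for the two endpoints of `e`, with public
communication `Q_e`, against the adversary who observes `Z ^ n`. -/
def IsPairSecret [Fintype G.edgeSet] [∀ e, MeasurableSpace (𝒱 e)] [∀ e, MeasurableSpace (𝒵 e)]
    (𝒦 : PairwiseKeys 𝒱 n) (S : PIN G 𝒱 𝒵) (e : G.edgeSet) (ε σ : ℝ) : Prop :=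
  IsSecretKey (S.iid n) {j | j ∈ (e : Sym2 (Fin m))}
    (fun _ ω => 𝒦.ext e (PIN.edgeVar ω e))
    (fun ω => 𝒦.ext e (PIN.edgeVar ω e))
    (fun ω j => 𝒦.comm e j (PIN.edgeVar ω e))
    PIN.eve ε σ

open Classical in
/-- The truncated pairwise key `S'_ji` as computed by terminal `j` from its own observation
(`0` if `i` is not a neighbour of `j`). -/
def localKey (𝒦 : PairwiseKeys 𝒱 n) {L : ℕ} (hL : ∀ e, L ≤ 𝒦.len e) (j : Fin m)
    (x : PIN.Obs 𝒱 n j) (i : Fin m) : Bits L :=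
  if h : G.Adj j i then
    truncBits (hL ⟨s(j, i), h⟩)
      (𝒦.ext ⟨s(j, i), h⟩ fun t => x t ⟨⟨s(j, i), h⟩, Sym2.mem_mk_left j i⟩)
  else 0

open Classical in
/-- The key agreement protocol on a tree with pendant edge `{r, s}`. With `j*` the neighbour of `j`
closest to the leaf `r`, terminal `j` broadcasts its part of the communication `Q_e` for each
edge `e` at `j`, and `F_ji = S'_jj* ⊕ S'_ji` for each other neighbour `i ≠ j*`. The leaf `r`
outputs `S'_rs`. Every other terminal `j` outputs the sum of `S'_jj*` and the broadcasts `F_ab`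
over the edges of the path from `j` to `s`, each edge being passed from `b` to `a`; for `j = s` this
is `S'_sr`. -/
def treeProtocol (𝒦 : PairwiseKeys 𝒱 n) (hG : G.IsTree) (r s : Fin m) {L : ℕ}
    (hL : ∀ e, L ≤ 𝒦.len e) : NonInteractiveProtocol (PIN.Obs 𝒱 n) (Bits L) where
  Msg j := (∀ e : {e : G.edgeSet // j ∈ (e : Sym2 (Fin m))}, 𝒦.Comm e.1) ×
    ({i // G.Adj j i ∧ i ≠ towards G r j} → Bits L)
  finite_msg j := by
    have := 𝒦.finite_comm
    infer_instance
  send j x :=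
    (fun e => 𝒦.comm e.1 ⟨j, e.2⟩ fun t => x t e,
      fun i => 𝒦.localKey hL j x (towards G r j) + 𝒦.localKey hL j x i)
  key j x f :=
    if j = r then 𝒦.localKey hL j x s
    else
      𝒦.localKey hL j x (towards G r j) +
        ((treePath hG j s).darts.map fun d =>
          if h : G.Adj d.snd d.fst ∧ d.fst ≠ towards G r d.snd then
            (f d.snd).2 ⟨d.fst, h⟩ else 0).sum

/-- The global key of the tree protocol, the truncated pairwise key `S'_rs` of the pendant edge,
is an `(ε, σ)`-secret key for all the terminals, with the transcript of the protocol as public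
communication, against the adversary who observes `Z ^ n`. -/
def IsGlobalSecret [Fintype G.edgeSet] [∀ e, MeasurableSpace (𝒱 e)] [∀ e, MeasurableSpace (𝒵 e)]
    (𝒦 : PairwiseKeys 𝒱 n) (S : PIN G 𝒱 𝒵) (hG : G.IsTree) (r s : Fin m) {L : ℕ}
    (hL : ∀ e, L ≤ 𝒦.len e) (ε σ : ℝ) : Prop :=
  IsSecretKey (S.iid n) (Set.univ : Set (Fin m))
    (fun j ω => (𝒦.treeProtocol hG r s hL).output j (PIN.obs ω))
    (fun ω => 𝒦.localKey hL r (PIN.obs ω r) s)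
    (fun ω => (𝒦.treeProtocol hG r s hL).transcript (PIN.obs ω))
    PIN.eve ε σ

end PairwiseKeys

end

/-!
The tree protocol makes no errors. Along the path from a node `j` to the neighbour `s` of the leaf
`r`, each broadcast used by `j` is the sum of the keys of two consecutive edges of the path, so that
in characteristic two the broadcasts telescope (`sum_darts_broadcast`) and `j` obtains the key of the
pendant edge (`PairwiseKeys.output_treeProtocol`). The tree enters only through the fact that the
neighbour of `j` closest to `r` is the next node on this path.

For the secrecy of the global key, statistical distance is used in its dual form `NearUniform`:
replacing the key by an independent uniform one changes no expectation of a `[0, 1]`-valued test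
function by more than `δ`. The triples of key, pairwise communication and adversary's observation are
independent over the edges, so replacing all the keys by independent uniform ones costs `|E| δ`
(`TVLe.pi`). All broadcasts are sums of two edge keys, so adding the same bit string to every key
leaves the broadcasts unchanged and shifts the global key; in the ideal world the global key is
therefore exactly uniform given the public data. Going back to the true law of the public data costs
another `|E| δ` (`nearUniform_pi`).

For the rate, no pairwise communication is needed. If the conditional probability of `W` given `Y`
is at most `θ` with high probability, then the second moment of a random function into `κ` shows that
some function of `W` is `√(|κ| θ)`-close to uniform given `Y`, up to the exceptional probability
(`exists_nearUniform_hash`). The weak law of large numbers for the truncated conditional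
information, whose mean exceeds any given rate below the possibly infinite conditional entropy,
allows `θ = 2 ^ (-n R')` with `R'` above the rate (`eventually_exists_extractor`). A diagonal choice
of rates increasing to the least edge entropy gives a limit equal to it (`exists_pairwiseKeys`).
-/

/-! ### Statistical distance in dual form -/

/-- `TVLe μ ν δ`: the integral of every `[0, 1]`-valued function under `μ` exceeds its integral under
`ν` by at most `δ`. Between probability measures this says that their total variation distance is at
most `δ`. -/
def TVLe {α : Type*} [MeasurableSpace α] (μ ν : Measure α) (δ : ℝ≥0∞) : Prop :=
  ∀ f : α → ℝ≥0∞, (∀ a, f a ≤ 1) → ∫⁻ a, f a ∂μ ≤ ∫⁻ a, f a ∂ν + δ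

theorem TVLe.symm {α : Type*} [MeasurableSpace α] [DiscreteMeasurableSpace α] {μ ν : Measure α}
    [IsProbabilityMeasure μ] [IsProbabilityMeasure ν] {δ : ℝ≥0∞} (h : TVLe μ ν δ) :
    TVLe ν μ δ := by
  intro f hf
  have key : ∀ ρ : Measure α, IsProbabilityMeasure ρ →
      ∫⁻ a, f a ∂ρ + ∫⁻ a, (1 - f a) ∂ρ = 1 := by
    intro ρ _
    rw [← lintegral_add_left (.of_discrete)]
    simp [add_tsub_cancel_of_le (hf _)]
  have h1 := h (fun a => 1 - f a) (fun a => tsub_le_self)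
  have hμ := key μ ‹_›
  have hν := key ν ‹_›
  have hfin : ∫⁻ a, (1 - f a) ∂ν ≠ ∞ := by
    intro h'
    simp [h'] at hν
  rw [← ENNReal.add_le_add_iff_right hfin]
  calc ∫⁻ a, f a ∂ν + ∫⁻ a, (1 - f a) ∂ν = ∫⁻ a, f a ∂μ + ∫⁻ a, (1 - f a) ∂μ := by rw [hν, hμ]
    _ ≤ ∫⁻ a, f a ∂μ + (∫⁻ a, (1 - f a) ∂ν + δ) := by gcongr
    _ = _ := by ring

/-- The total variation distance is subadditive over the factors of product measures: the
coordinates are replaced one at a time. -/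
theorem TVLe.pi {ι : Type*} [Fintype ι] {A : ι → Type*} [∀ i, Countable (A i)]
    [∀ i, MeasurableSpace (A i)] [∀ i, DiscreteMeasurableSpace (A i)]
    {μ ν : ∀ i, Measure (A i)} [∀ i, IsProbabilityMeasure (μ i)] [∀ i, IsProbabilityMeasure (ν i)]
    {δ : ℝ≥0∞} (h : ∀ i, TVLe (μ i) (ν i) δ) :
    TVLe (Measure.pi μ) (Measure.pi ν) (Fintype.card ι * δ) := by
  classical
  have main : ∀ s : Finset ι, ∀ f : (∀ i, A i) → ℝ≥0∞, (∀ a, f a ≤ 1) →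
      ∀ x, lmarginal μ s f x ≤ lmarginal ν s f x + s.card * δ := by
    intro s
    induction s using Finset.induction_on with
    | empty => intro f _ x; simp
    | insert i s hi ih =>
      intro f hf x
      rw [lmarginal_insert' _ .of_discrete hi, lmarginal_insert' _ .of_discrete hi]
      have hg : ∀ a, (fun y => ∫⁻ t, f (Function.update y i t) ∂ν i) a ≤ 1 := by
        intro a
        calc _ ≤ ∫⁻ _, 1 ∂ν i := lintegral_mono fun t => hf _
          _ = 1 := by simp
      calc lmarginal μ s (fun y => ∫⁻ t, f (Function.update y i t) ∂μ i) x
          ≤ lmarginal μ s (fun y => (∫⁻ t, f (Function.update y i t) ∂ν i) + δ) x :=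
            lmarginal_mono (fun y => h i _ fun t => hf _) x
        _ = lmarginal μ s (fun y => ∫⁻ t, f (Function.update y i t) ∂ν i) x + δ := by
            simp only [lmarginal]
            rw [lintegral_add_left .of_discrete]
            simp
        _ ≤ lmarginal ν s (fun y => ∫⁻ t, f (Function.update y i t) ∂ν i) x + s.card * δ + δ := by
            gcongr
            exact ih _ hg x
        _ = _ := by
            rw [Finset.card_insert_of_notMem hi]
            push_cast
            ring
  intro f hf
  have hne : Nonempty (∀ i, A i) := by
    by_contra hcon
    rw [not_nonempty_iff] at hcon
    have h1 := measure_univ (μ := Measure.pi μ)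
    rw [Set.univ_eq_empty_iff.2 hcon] at h1
    simp at h1
  have := main Finset.univ f hf hne.some
  simpa using this

/-- Dual form of the secrecy of the key `K` against the observation `Y`: replacing `K` by an
independent uniform key changes the expectation of a `[0, 1]`-valued function of `(K, Y)` by at
most `δ`. -/
def NearUniform {Ω κ η : Type*} [MeasurableSpace Ω] (μ : Measure Ω) [Fintype κ]
    (K : Ω → κ) (Y : Ω → η) (δ : ℝ≥0∞) : Prop :=
  ∀ f : κ → η → ℝ≥0∞, (∀ k y, f k y ≤ 1) →
    ∫⁻ ω, f (K ω) (Y ω) ∂μ ≤ (Fintype.card κ : ℝ≥0∞)⁻¹ * ∑ k, ∫⁻ ω, f k (Y ω) ∂μ + δ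

theorem ofReal_massFn {Ω α : Type*} [MeasurableSpace Ω] {μ : Measure Ω} [IsFiniteMeasure μ]
    (X : Ω → α) (a : α) : ENNReal.ofReal (massFn μ X a) = μ {ω | X ω = a} := by
  simp [massFn]

theorem massFn_nonneg {Ω α : Type*} [MeasurableSpace Ω] {μ : Measure Ω} (X : Ω → α) (a : α) :
    0 ≤ massFn μ X a := measureReal_nonneg

theorem lintegral_comp_eq_tsum {Ω α : Type*} [MeasurableSpace Ω] [DiscreteMeasurableSpace Ω]
    {μ : Measure Ω} [IsFiniteMeasure μ] [Countable α] (X : Ω → α) (f : α → ℝ≥0∞) :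
    ∫⁻ ω, f (X ω) ∂μ = ∑' a, f a * ENNReal.ofReal (massFn μ X a) := by
  let _ : MeasurableSpace α := ⊤
  have : DiscreteMeasurableSpace α := ⟨fun _ => trivial⟩
  rw [← lintegral_map (μ := μ) (f := f) (g := X) .of_discrete .of_discrete, lintegral_countable']
  refine tsum_congr fun a => ?_
  rw [Measure.map_apply .of_discrete .of_discrete, ofReal_massFn]
  rfl

theorem statDist_nonneg {α : Type*} (p q : α → ℝ) : 0 ≤ statDist p q :=
  mul_nonneg (by norm_num) (tsum_nonneg fun _ => abs_nonneg _)

section DualForm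

variable {Ω : Type*} [MeasurableSpace Ω] [DiscreteMeasurableSpace Ω]
  {μ : Measure Ω} [IsProbabilityMeasure μ]

theorem tsum_ofReal_massFn {α : Type*} [Countable α] (X : Ω → α) :
    ∑' a, ENNReal.ofReal (massFn μ X a) = 1 := by
  simpa using (lintegral_comp_eq_tsum (μ := μ) X (fun _ => 1)).symm

theorem hasSum_massFn {α : Type*} [Countable α] (X : Ω → α) : HasSum (massFn μ X) 1 := by
  have h : ∑' a, ENNReal.ofReal (massFn μ X a) ≠ ∞ := by simp [tsum_ofReal_massFn]
  have h2 := ENNReal.hasSum_toReal h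
  rw [← ENNReal.tsum_toReal_eq (fun _ => ENNReal.ofReal_ne_top), tsum_ofReal_massFn] at h2
  simpa [ENNReal.toReal_ofReal (massFn_nonneg _ _)] using h2

/-- On two probability mass functions, the positive part of the difference has half the mass of its
absolute value. -/
theorem tsum_ofReal_sub {α : Type*} {p q : α → ℝ} (hp : HasSum p 1) (hq : HasSum q 1) :
    ∑' a, ENNReal.ofReal (p a - q a) = ENNReal.ofReal (statDist p q) := by
  have hd : HasSum (fun a => p a - q a) 0 := by simpa using hp.sub hq
  have hpos : ∀ a, max (p a - q a) 0 = (1 / 2) * (|p a - q a| + (p a - q a)) := by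
    intro a
    rcases le_total 0 (p a - q a) with h | h
    · rw [max_eq_left h, abs_of_nonneg h]; ring
    · rw [max_eq_right h, abs_of_nonpos h]; ring
  have habs : Summable fun a => |p a - q a| := hd.summable.abs
  have hs : HasSum (fun a => max (p a - q a) 0) (statDist p q) := by
    simp only [hpos, statDist]
    have := (habs.hasSum.add hd).mul_left (1 / 2)
    rwa [add_zero] at this
  rw [← hs.tsum_eq, ENNReal.ofReal_tsum_of_nonneg (fun a => le_max_right _ _) hs.summable]
  refine tsum_congr fun a => ?_
  rw [ENNReal.ofReal_max]
  simp

variable {κ η : Type*} [Fintype κ] [Nonempty κ] [Countable η]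

theorem hasSum_uniform_mul_massFn (Y : Ω → η) :
    HasSum (fun w : κ × η => (Fintype.card κ : ℝ)⁻¹ * massFn μ Y w.2) 1 := by
  have h1 : HasSum (fun _ : κ => (Fintype.card κ : ℝ)⁻¹) 1 := by
    have := hasSum_fintype (fun _ : κ => (Fintype.card κ : ℝ)⁻¹)
    simpa using this
  have h2 := hasSum_massFn (μ := μ) Y
  simpa using h1.mul h2 (h1.summable.mul_of_nonneg h2.summable
    (fun _ => by positivity) (massFn_nonneg Y))

theorem uniform_lintegral_eq_tsum (Y : Ω → η) (f : κ → η → ℝ≥0∞) :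
    (Fintype.card κ : ℝ≥0∞)⁻¹ * ∑ k, ∫⁻ ω, f k (Y ω) ∂μ =
      ∑' w : κ × η, f w.1 w.2 *
        ENNReal.ofReal ((Fintype.card κ : ℝ)⁻¹ * massFn μ Y w.2) := by
  rw [ENNReal.tsum_prod', tsum_fintype, Finset.mul_sum]
  refine Finset.sum_congr rfl fun k _ => ?_
  rw [lintegral_comp_eq_tsum, ← ENNReal.tsum_mul_left]
  refine tsum_congr fun y => ?_
  rw [ENNReal.ofReal_mul (by positivity), ENNReal.ofReal_inv_of_pos (by positivity),
    ENNReal.ofReal_natCast]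
  ring

/-- The dual form of the statistical distance between `(K, Y)` and `(U, Y)`. -/
theorem statDist_le_iff_nearUniform (K : Ω → κ) (Y : Ω → η) {σ : ℝ} (hσ : 0 ≤ σ) :
    statDist (massFn μ (fun ω => (K ω, Y ω)))
      (fun w : κ × η => (Fintype.card κ : ℝ)⁻¹ * massFn μ Y w.2) ≤ σ ↔
    NearUniform μ K Y (ENNReal.ofReal σ) := by
  set p := massFn μ (fun ω => (K ω, Y ω)) with hp
  set q := fun w : κ × η => (Fintype.card κ : ℝ)⁻¹ * massFn μ Y w.2 with hq
  have hps : HasSum p 1 := hasSum_massFn _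
  have hqs : HasSum q 1 := hasSum_uniform_mul_massFn Y
  have hp0 : ∀ w, 0 ≤ p w := massFn_nonneg _
  have hq0 : ∀ w, 0 ≤ q w := fun w => mul_nonneg (by positivity) (massFn_nonneg _ _)
  have hsum := tsum_ofReal_sub hps hqs
  have hE : ∀ f : κ → η → ℝ≥0∞, ∫⁻ ω, f (K ω) (Y ω) ∂μ =
      ∑' w : κ × η, f w.1 w.2 * ENNReal.ofReal (p w) := fun f =>
    lintegral_comp_eq_tsum (μ := μ) (fun ω => (K ω, Y ω)) (fun w => f w.1 w.2)
  rw [← ENNReal.ofReal_le_ofReal_iff hσ, ← hsum]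
  constructor
  · intro h f hf
    rw [hE, uniform_lintegral_eq_tsum]
    calc ∑' w : κ × η, f w.1 w.2 * ENNReal.ofReal (p w)
        ≤ ∑' w : κ × η, (f w.1 w.2 * ENNReal.ofReal (q w) + ENNReal.ofReal (p w - q w)) := by
          refine ENNReal.tsum_le_tsum fun w => ?_
          calc f w.1 w.2 * ENNReal.ofReal (p w)
              ≤ f w.1 w.2 * (ENNReal.ofReal (q w) + ENNReal.ofReal (p w - q w)) := by
                gcongr
                rw [← tsub_le_iff_left, ENNReal.ofReal_sub _ (hq0 w)]
            _ ≤ _ := by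
                rw [mul_add]
                gcongr
                exact mul_le_of_le_one_left' (hf _ _)
      _ ≤ _ := by
          rw [ENNReal.tsum_add]
          gcongr
  · intro h
    classical
    let g : κ → η → ℝ≥0∞ := fun k y => if q (k, y) ≤ p (k, y) then 1 else 0
    have h1 := h g (fun k y => by simp only [g]; split_ifs <;> simp)
    rw [hE g, uniform_lintegral_eq_tsum Y g] at h1
    have hsplit : ∀ w : κ × η, (if q w ≤ p w then 1 else 0) * ENNReal.ofReal (p w) =
        (if q w ≤ p w then 1 else 0) * ENNReal.ofReal (q w) + ENNReal.ofReal (p w - q w) := by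
      intro w
      split_ifs with hw
      · rw [one_mul, one_mul, ← ENNReal.ofReal_add (hq0 w) (by linarith)]
        congr 1; ring
      · simp [ENNReal.ofReal_of_nonpos (by linarith : p w - q w ≤ 0)]
    have h2 : ∑' w : κ × η, (if q w ≤ p w then 1 else 0) * ENNReal.ofReal (p w) ≤
        ∑' w : κ × η, (if q w ≤ p w then 1 else 0) * ENNReal.ofReal (q w) +
          ENNReal.ofReal σ := h1
    simp_rw [hsplit] at h2
    rw [ENNReal.tsum_add] at h2
    have hfin : ∑' w : κ × η, (if q w ≤ p w then 1 else 0) * ENNReal.ofReal (q w) ≠ ∞ := by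
      refine ne_top_of_le_ne_top ENNReal.one_ne_top ?_
      calc _ ≤ ∑' w, ENNReal.ofReal (q w) := ENNReal.tsum_le_tsum fun w => by split_ifs <;> simp
        _ = ENNReal.ofReal 1 := by
            rw [← hqs.tsum_eq, ENNReal.ofReal_tsum_of_nonneg hq0 hqs.summable]
        _ = 1 := by simp
    exact (ENNReal.add_le_add_iff_left hfin).1 h2

end DualForm

/-! ### Routing in a tree -/

section TreeRouting

variable {m : ℕ} {G : SimpleGraph (Fin m)}

theorem exists_isPendant (hm : 2 ≤ m) (hG : G.IsTree) : ∃ r s : Fin m, IsPendant G r s := by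
  classical
  have : Nontrivial (Fin m) := Fin.nontrivial_iff_two_le.2 hm
  obtain ⟨r, hr⟩ := hG.exists_vert_degree_one_of_nontrivial
  obtain ⟨s, hs, hu⟩ := SimpleGraph.degree_eq_one_iff_existsUnique_adj.1 hr
  exact ⟨r, s, fun i => ⟨fun h => hu i h, fun h => h ▸ hs⟩⟩

/-- In a tree, at most one neighbour of `j` is closer to `r` than `j` is. -/
theorem eq_of_dist_lt (hG : G.IsTree) {r j p q : Fin m} (hp : G.Adj j p) (hq : G.Adj j q)
    (hpd : G.dist r p < G.dist r j) (hqd : G.dist r q < G.dist r j) : p = q := by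
  obtain ⟨u, hu, hul⟩ := (hG.connected p r).exists_path_of_dist
  obtain ⟨w, hw, hwl⟩ := (hG.connected q r).exists_path_of_dist
  have key : ∀ (x : Fin m) (v : G.Walk x r) (hx : G.Adj j x), v.IsPath →
      v.length = G.dist x r → G.dist r x < G.dist r j → (v.cons hx).IsPath := by
    intro x v hx hv hl hd
    rw [SimpleGraph.Walk.cons_isPath_iff]
    refine ⟨hv, fun hj => ?_⟩
    have h1 := SimpleGraph.dist_le (v.dropUntil j hj)
    have h2 := v.length_dropUntil_le_length hj
    rw [SimpleGraph.dist_comm] at h1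
    rw [SimpleGraph.dist_comm] at hl
    omega
  have := (hG.isAcyclic.subsingleton_path j r).elim
    ⟨_, key p u hp hu hul hpd⟩ ⟨_, key q w hq hw hwl hqd⟩
  have h3 := congrArg (fun v : G.Path j r => v.1.snd) this
  simpa using h3

theorem exists_adj_dist_lt (hG : G.IsTree) {r j : Fin m} (hj : j ≠ r) :
    ∃ p, G.Adj j p ∧ G.dist r p < G.dist r j := by
  obtain ⟨w, hw, hwl⟩ := (hG.connected j r).exists_path_of_dist
  cases w with
  | nil => exact absurd rfl hj
  | cons h v =>
    refine ⟨_, h, ?_⟩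
    have := SimpleGraph.dist_le v
    rw [SimpleGraph.Walk.length_cons] at hwl
    rw [SimpleGraph.dist_comm, SimpleGraph.dist_comm (u := r)]
    omega

theorem towards_eq {r j p : Fin m} (hp : G.Adj j p)
    (h : ∀ i, G.Adj j i → i ≠ p → G.dist r p < G.dist r i) : towards G r j = p := by
  have hex : ∃ p, G.Adj j p ∧ ∀ i, G.Adj j i → i ≠ p → G.dist r p < G.dist r i := ⟨p, hp, h⟩
  rw [towards, dif_pos hex]
  by_contra hne
  have h1 := h _ hex.choose_spec.1 hne
  have h2 := hex.choose_spec.2 p hp (Ne.symm hne)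
  omega

/-- In a tree, `towards G r j` is the only neighbour of `j ≠ r` that is closer to `r` than `j`. -/
theorem towards_eq_of_dist_lt (hG : G.IsTree) {r j p : Fin m} (hp : G.Adj j p)
    (hd : G.dist r p < G.dist r j) : towards G r j = p := by
  refine towards_eq hp fun i hi hne => ?_
  rcases lt_trichotomy (G.dist r i) (G.dist r j) with h | h | h
  · exact absurd (eq_of_dist_lt hG hi hp h hd) hne
  · exact absurd h.symm (hG.dist_ne_of_adj r hi)
  · omega

theorem towards_spec (hG : G.IsTree) {r j : Fin m} (hj : j ≠ r) :
    G.Adj j (towards G r j) ∧ G.dist r (towards G r j) < G.dist r j := by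
  obtain ⟨p, hp, hd⟩ := exists_adj_dist_lt hG hj
  rw [towards_eq_of_dist_lt hG hp hd]
  exact ⟨hp, hd⟩

theorem towards_root {r s : Fin m} (hrs : IsPendant G r s) : towards G r r = s :=
  towards_eq ((hrs s).2 rfl) fun i hi hne => absurd ((hrs i).1 hi) hne

theorem adj_towards (hG : G.IsTree) {r s : Fin m} (hrs : IsPendant G r s) (j : Fin m) :
    G.Adj j (towards G r j) := by
  by_cases hj : j = r
  · subst hj
    rw [towards_root hrs]
    exact (hrs s).2 rfl
  · exact (towards_spec hG hj).1

theorem IsPendant.ne {r s : Fin m} (hrs : IsPendant G r s) : s ≠ r := ((hrs s).2 rfl).ne'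

theorem towards_pendant (hG : G.IsTree) {r s : Fin m} (hrs : IsPendant G r s) :
    towards G r s = r := by
  refine towards_eq_of_dist_lt hG ((hrs s).2 rfl).symm ?_
  rw [SimpleGraph.dist_self]
  exact (hG.connected r s).pos_dist_of_ne hrs.ne.symm

/-- A path towards the neighbour `s` of the leaf `r` that avoids `r` gets closer to `r` in each of
its steps. -/
theorem dist_lt_of_mem_darts (hG : G.IsTree) {r s : Fin m} (hrs : IsPendant G r s) :
    ∀ {j : Fin m} (w : G.Walk j s), w.IsPath → r ∉ w.support →
      ∀ d ∈ w.darts, d.fst ≠ r ∧ d.snd ≠ r ∧ G.dist r d.snd < G.dist r d.fst := by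
  have hsr : G.Adj s r := ((hrs s).2 rfl).symm
  have hlen : ∀ {x : Fin m} (v : G.Walk x s), v.IsPath → r ∉ v.support →
      G.dist r x = v.length + 1 := by
    intro x v hv hr
    obtain ⟨u, hu, hul⟩ := (hG.connected x r).exists_path_of_dist
    have h1 : (v.concat hsr).IsPath := hv.concat hr hsr
    have := congrArg (fun w : G.Path x r => w.1.length)
      ((hG.isAcyclic.subsingleton_path x r).elim ⟨u, hu⟩ ⟨_, h1⟩)
    simp only [SimpleGraph.Walk.length_concat] at this
    rw [SimpleGraph.dist_comm, ← hul, this]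
  intro j w
  induction w with
  | nil => intro _ _ d hd; simp at hd
  | cons h v ih =>
    intro hp hr d hd
    have hp' := hp
    have hr' := hr
    rw [SimpleGraph.Walk.cons_isPath_iff] at hp
    rw [SimpleGraph.Walk.support_cons, List.mem_cons, not_or] at hr
    rw [SimpleGraph.Walk.darts_cons, List.mem_cons] at hd
    rcases hd with rfl | hd
    · refine ⟨fun h' => hr.1 h'.symm, fun h' => hr.2 (h' ▸ v.start_mem_support), ?_⟩
      have h1 := hlen v hp.1 hr.2
      have h2 := hlen _ hp' hr'
      rw [SimpleGraph.Walk.length_cons] at h2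
      simp only
      omega
    · exact ih hrs hsr hlen hp.1 hr.2 d hd

theorem root_notMem_treePath (hG : G.IsTree) {r s j : Fin m} (hrs : IsPendant G r s)
    (hj : j ≠ r) : r ∉ (treePath hG j s).support := by
  have hp : (treePath hG j s).IsPath := (hG.existsUnique_path j s).choose_spec.1
  intro hr
  -- The vertex before `r` would be `s`, the endpoint of the path.
  have hnil : ¬ ((treePath hG j s).takeUntil r hr).Nil := SimpleGraph.Walk.not_nil_of_ne hj
  have h2 := (hrs _).1 (SimpleGraph.Walk.adj_penultimate hnil).symm
  have h1 := SimpleGraph.Walk.getVert_mem_support ((treePath hG j s).takeUntil r hr)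
    (((treePath hG j s).takeUntil r hr).length - 1)
  exact SimpleGraph.Walk.endpoint_notMem_support_takeUntil hp hr hrs.ne
    (Eq.mp (congrArg (fun x => x ∈ ((treePath hG j s).takeUntil r hr).support) h2) h1)

/-- The broadcasts along a path towards the leaf telescope: each of them is the sum of the keys of
two consecutive edges. -/
theorem sum_darts_broadcast {A : Type*} [AddCommGroup A] (h2 : ∀ a : A, a + a = 0)
    (hG : G.IsTree) {r s : Fin m} (key : Fin m → Fin m → A) (hsymm : ∀ i j, key i j = key j i)
    (f : ∀ a b, (G.Adj a b ∧ b ≠ towards G r a) → A)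
    (hf : ∀ a b h, f a b h = key a (towards G r a) + key a b)
    [∀ a b, Decidable (G.Adj a b ∧ b ≠ towards G r a)] :
    ∀ {j : Fin m} (w : G.Walk j s),
      (∀ d ∈ w.darts, d.fst ≠ r ∧ d.snd ≠ r ∧ G.dist r d.snd < G.dist r d.fst) →
      (w.darts.map fun d =>
        if h : G.Adj d.snd d.fst ∧ d.fst ≠ towards G r d.snd then f d.snd d.fst h else 0).sum =
      key j (towards G r j) + key s (towards G r s) := by
  intro j w
  induction w with
  | nil => intro _; simp [h2]
  | @cons u v t h w ih =>
    intro hd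
    have h0 := hd ⟨(u, v), h⟩ (by simp)
    simp only at h0
    have hu : towards G r u = v := towards_eq_of_dist_lt hG h h0.2.2
    have hne : u ≠ towards G r v := fun h' => by
      have := (towards_spec hG h0.2.1).2
      rw [← h'] at this
      omega
    rw [SimpleGraph.Walk.darts_cons, List.map_cons, List.sum_cons,
      ih (fun d hd' => hd d (by simp [hd']))]
    simp only
    rw [dif_pos ⟨h.symm, hne⟩, hf, hu, hsymm v u]
    have := h2 (key v (towards G r v))
    rw [show ∀ a b c : A, a + b + (a + c) = (a + a) + (b + c) from fun a b c => by abel, this,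
      zero_add]

theorem bits_add_self {L : ℕ} (a : Bits L) : a + a = 0 := by
  funext i
  exact CharTwo.add_self_eq_zero (a i)

variable {𝒱 𝒵 : G.edgeSet → Type*} {n : ℕ} (𝒦 : PairwiseKeys 𝒱 n) {L : ℕ}
  (hL : ∀ e, L ≤ 𝒦.len e)

/-- The truncated pairwise key of the edge `e` as a function of the samples. -/
def PairwiseKeys.edgeKey (e : G.edgeSet) (ω : PIN.Sample 𝒱 𝒵 n) : Bits L :=
  truncBits (hL e) (𝒦.ext e (PIN.edgeVar ω e))

theorem PairwiseKeys.localKey_eq {j i : Fin m} (h : G.Adj j i) (ω : PIN.Sample 𝒱 𝒵 n) :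
    𝒦.localKey hL j (PIN.obs ω j) i = 𝒦.edgeKey hL ⟨s(j, i), h⟩ ω := by
  rw [PairwiseKeys.localKey, dif_pos h]
  rfl

theorem PairwiseKeys.localKey_comm (j i : Fin m) (ω : PIN.Sample 𝒱 𝒵 n) :
    𝒦.localKey hL j (PIN.obs ω j) i = 𝒦.localKey hL i (PIN.obs ω i) j := by
  by_cases h : G.Adj j i
  · rw [𝒦.localKey_eq hL h, 𝒦.localKey_eq hL h.symm]
    congr 2
    exact Sym2.eq_swap
  · rw [PairwiseKeys.localKey, dif_neg h, PairwiseKeys.localKey, dif_neg fun h' => h h'.symm]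

/-- The tree protocol is free of errors: every terminal computes the key of the pendant edge. -/
theorem PairwiseKeys.output_treeProtocol (hG : G.IsTree) {r s : Fin m} (hrs : IsPendant G r s)
    (ω : PIN.Sample 𝒱 𝒵 n) (j : Fin m) :
    (𝒦.treeProtocol hG r s hL).output j (PIN.obs ω) = 𝒦.localKey hL r (PIN.obs ω r) s := by
  classical
  by_cases hj : j = r
  · subst hj
    simp [NonInteractiveProtocol.output, PairwiseKeys.treeProtocol]
  · have hp : (treePath hG j s).IsPath := (hG.existsUnique_path j s).choose_spec.1
    have h := sum_darts_broadcast (r := r) bits_add_self hG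
      (fun a b => 𝒦.localKey hL a (PIN.obs ω a) b) (fun a b => 𝒦.localKey_comm hL a b ω)
      (fun a b _ => 𝒦.localKey hL a (PIN.obs ω a) (towards G r a) +
        𝒦.localKey hL a (PIN.obs ω a) b) (fun _ _ _ => rfl) (treePath hG j s)
      (dist_lt_of_mem_darts hG hrs _ hp (root_notMem_treePath hG hrs hj))
    have h' : (𝒦.treeProtocol hG r s hL).output j (PIN.obs ω) =
        𝒦.localKey hL j (PIN.obs ω j) (towards G r j) +
          (𝒦.localKey hL j (PIN.obs ω j) (towards G r j) +
            𝒦.localKey hL s (PIN.obs ω s) (towards G r s)) := by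
      rw [← h]
      simp only [NonInteractiveProtocol.output, PairwiseKeys.treeProtocol, if_neg hj]
      congr!
    rw [h', ← add_assoc, bits_add_self, zero_add, towards_pendant hG hrs, 𝒦.localKey_comm]

end TreeRouting

/-! ### Secrecy of the global key -/

section IndependentKeys

/-- The uniform probability measure on a finite set. -/
noncomputable def unifMeasure (κ : Type*) [Fintype κ] [MeasurableSpace κ] : Measure κ :=
  (Fintype.card κ : ℝ≥0∞)⁻¹ • Measure.count

section

variable {κ : Type*} [Fintype κ] [MeasurableSpace κ] [DiscreteMeasurableSpace κ]

theorem lintegral_unifMeasure (f : κ → ℝ≥0∞) :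
    ∫⁻ k, f k ∂unifMeasure κ = (Fintype.card κ : ℝ≥0∞)⁻¹ * ∑ k, f k := by
  rw [unifMeasure, lintegral_smul_measure, lintegral_count, tsum_fintype, smul_eq_mul]

instance [Nonempty κ] : IsProbabilityMeasure (unifMeasure κ) := by
  constructor
  rw [← lintegral_one, lintegral_unifMeasure]
  simp only [Finset.sum_const, Finset.card_univ, nsmul_eq_mul, mul_one]
  exact ENNReal.inv_mul_cancel (by simp) (by simp)

theorem measurePreserving_add_unifMeasure [AddCommGroup κ] (c : κ) :
    MeasurePreserving (fun k => k + c) (unifMeasure κ) (unifMeasure κ) := by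
  refine ⟨.of_discrete, ?_⟩
  ext s hs
  rw [← lintegral_indicator_one hs, ← lintegral_indicator_one hs,
    lintegral_map .of_discrete .of_discrete, lintegral_unifMeasure, lintegral_unifMeasure]
  congr 1
  exact Equiv.sum_comp (Equiv.addRight c) (s.indicator (1 : κ → ℝ≥0∞))

end

theorem NearUniform.comp {Ω κ η θ : Type*} [MeasurableSpace Ω] {μ : Measure Ω} [Fintype κ]
    {K : Ω → κ} {Y : Ω → η} {δ : ℝ≥0∞} (h : NearUniform μ K Y δ) (φ : η → θ) :
    NearUniform μ K (fun ω => φ (Y ω)) δ :=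
  fun f hf => h (fun k y => f k (φ y)) fun _ _ => hf _ _

/-- Secrecy is preserved by a surjective homomorphism between key groups, since it maps the uniform
distribution to the uniform distribution. -/
theorem NearUniform.map_hom {Ω κ κ' η : Type*} [MeasurableSpace Ω] {μ : Measure Ω} [Fintype κ]
    [Fintype κ'] [AddCommGroup κ] [AddCommGroup κ'] {K : Ω → κ} {Y : Ω → η} {δ : ℝ≥0∞}
    (h : NearUniform μ K Y δ) (φ : κ →+ κ') (hφ : Function.Surjective φ) :
    NearUniform μ (fun ω => φ (K ω)) Y δ := by
  classical
  intro f hf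
  refine (h (fun k y => f (φ k) y) fun _ _ => hf _ _).trans_eq ?_
  congr 1
  set N := Nat.card φ.ker
  have hfib : ∀ b : κ', (Finset.univ.filter fun a => φ a = b).card = N := by
    intro b
    rw [← AddMonoidHom.card_fiber_eq_of_mem_range φ (hφ 0) (hφ b)]
    simp [N, Fintype.card_subtype, AddMonoidHom.mem_ker, Nat.card_eq_fintype_card]
  have hsum : ∀ g : κ' → ℝ≥0∞, ∑ a, g (φ a) = N * ∑ b, g b := by
    intro g
    rw [← Finset.sum_fiberwise' Finset.univ φ g, Finset.mul_sum]
    simp [hfib]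
  have hN : (N : ℝ≥0∞) ≠ 0 := by
    have : 0 < N := Nat.card_pos
    simp [this.ne']
  have hcard : (Fintype.card κ : ℝ≥0∞) = N * Fintype.card κ' := by
    simpa using hsum (fun _ => 1)
  rw [hsum (fun b => ∫⁻ ω, f b (Y ω) ∂μ), hcard,
    ENNReal.mul_inv (.inl hN) (.inl (by simp)), mul_mul_mul_comm, mul_comm _ (N : ℝ≥0∞),
    ENNReal.mul_inv_cancel hN (by simp), one_mul]

/-- Let `(k e, y e)`, for `e` in a finite set, be independent pairs such that each key `k e` is
`δ`-near uniform given `y e`. If the data `T` is unchanged when a constant is added to all the keys,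
then every single key is near uniform given `T` of all the keys and all the `y e`. -/
theorem nearUniform_pi {E Θ κ : Type*} [Fintype E] [AddCommGroup κ] [Fintype κ] {X η : E → Type*}
    [∀ e, MeasurableSpace (X e)] [∀ e, Countable (X e)] [∀ e, DiscreteMeasurableSpace (X e)]
    [∀ e, Countable (η e)] (μ : ∀ e, Measure (X e)) [∀ e, IsProbabilityMeasure (μ e)]
    (k : ∀ e, X e → κ) (y : ∀ e, X e → η e) {δ : ℝ≥0∞}
    (h : ∀ e, NearUniform (μ e) (k e) (y e) δ) (r : E) (T : (E → κ) → Θ)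
    (hT : ∀ u c, T (fun e => u e + c) = T u) :
    NearUniform (Measure.pi μ) (fun ω => k r (ω r))
      (fun ω => (T (fun e => k e (ω e)), fun e => y e (ω e))) (2 * Fintype.card E * δ) := by
  let _ : MeasurableSpace κ := ⊤
  have : DiscreteMeasurableSpace κ := ⟨fun _ => trivial⟩
  let _ : ∀ e, MeasurableSpace (η e) := fun _ => ⊤
  have : ∀ e, DiscreteMeasurableSpace (η e) := fun _ => ⟨fun _ => trivial⟩
  let A : E → Type _ := fun e => κ × η e
  let b : ∀ e, X e → A e := fun e x => (k e x, y e x)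
  let μ' : ∀ e, Measure (A e) := fun e => (μ e).map (b e)
  let ν' : ∀ e, Measure (A e) := fun e => (unifMeasure κ).prod ((μ e).map (y e))
  have hμ' : ∀ e, IsProbabilityMeasure (μ' e) := fun e =>
    Measure.isProbabilityMeasure_map .of_discrete
  have hy' : ∀ e, IsProbabilityMeasure ((μ e).map (y e)) := fun e =>
    Measure.isProbabilityMeasure_map .of_discrete
  have hν' : ∀ e, IsProbabilityMeasure (ν' e) := fun e => by dsimp only [ν']; infer_instance
  have htv : ∀ e, TVLe (μ' e) (ν' e) δ := by
    intro e f hf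
    have h1 := h e (fun c z => f (c, z)) fun _ _ => hf _
    dsimp only [μ', ν']
    rw [lintegral_map .of_discrete .of_discrete,
      lintegral_prod _ (Measurable.of_discrete).aemeasurable, lintegral_unifMeasure]
    refine h1.trans_eq ?_
    congr 3
    funext c
    rw [lintegral_map .of_discrete .of_discrete]
  have hpi := TVLe.pi htv
  have hpi' := hpi.symm
  have hmap : (Measure.pi μ).map (fun ω e => b e (ω e)) = Measure.pi μ' :=
    Measure.pi_map_pi fun e => Measurable.of_discrete.aemeasurable
  have hint : ∀ F : (∀ e, A e) → ℝ≥0∞,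
      ∫⁻ a, F a ∂Measure.pi μ' = ∫⁻ ω, F (fun e => b e (ω e)) ∂Measure.pi μ := by
    intro F
    rw [← hmap, lintegral_map .of_discrete .of_discrete]
  have hshift : ∀ c : κ, MeasurePreserving (fun (a : ∀ e, A e) e => ((a e).1 + c, (a e).2))
      (Measure.pi ν') (Measure.pi ν') := fun c =>
    measurePreserving_pi ν' ν' (f := fun e (x : A e) => ((x.1 + c, x.2) : A e)) fun e =>
      (measurePreserving_add_unifMeasure c).prod (MeasurePreserving.id _)
  intro f hf
  let Ψ : (∀ e, A e) → Θ × (∀ e, η e) := fun a => (T (fun e => (a e).1), fun e => (a e).2)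
  -- Averaging over a common shift `c` of all keys, which does not change `Ψ`, makes the key uniform.
  have hideal : ∫⁻ a, f (a r).1 (Ψ a) ∂Measure.pi ν' =
      (Fintype.card κ : ℝ≥0∞)⁻¹ * ∑ c, ∫⁻ a, f c (Ψ a) ∂Measure.pi ν' := by
    have h1 : ∀ c, ∫⁻ a, f ((a r).1 + c) (Ψ a) ∂Measure.pi ν' =
        ∫⁻ a, f (a r).1 (Ψ a) ∂Measure.pi ν' := by
      intro c
      rw [← (hshift c).lintegral_comp (f := fun a => f (a r).1 (Ψ a)) .of_discrete]
      simp only [Ψ, hT]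
    have h2 : ∑ c, ∫⁻ a, f c (Ψ a) ∂Measure.pi ν' =
        ∑ c, ∫⁻ a, f ((a r).1 + c) (Ψ a) ∂Measure.pi ν' := by
      rw [← lintegral_finsetSum _ fun _ _ => .of_discrete,
        ← lintegral_finsetSum _ fun _ _ => .of_discrete]
      refine lintegral_congr fun a => ?_
      exact (Equiv.sum_comp (Equiv.addLeft (a r).1) fun c => f c (Ψ a)).symm
    rw [h2]
    simp only [h1, Finset.sum_const, Finset.card_univ, nsmul_eq_mul]
    rw [← mul_assoc, ENNReal.inv_mul_cancel (by simp) (by simp), one_mul]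
  calc ∫⁻ ω, f (k r (ω r)) (T (fun e => k e (ω e)), fun e => y e (ω e)) ∂Measure.pi μ
      = ∫⁻ a, f (a r).1 (Ψ a) ∂Measure.pi μ' := (hint fun a => f (a r).1 (Ψ a)).symm
    _ ≤ ∫⁻ a, f (a r).1 (Ψ a) ∂Measure.pi ν' + Fintype.card E * δ := hpi _ fun _ => hf _ _
    _ ≤ (Fintype.card κ : ℝ≥0∞)⁻¹ *
          ∑ c, (∫⁻ a, f c (Ψ a) ∂Measure.pi μ' + Fintype.card E * δ) + Fintype.card E * δ := by
        rw [hideal]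
        gcongr with c
        exact hpi' _ fun _ => hf _ _
    _ = (Fintype.card κ : ℝ≥0∞)⁻¹ * ∑ c, ∫⁻ a, f c (Ψ a) ∂Measure.pi μ' +
          2 * Fintype.card E * δ := by
        rw [Finset.sum_add_distrib, mul_add, Finset.sum_const, Finset.card_univ, nsmul_eq_mul,
          ← mul_assoc, ENNReal.inv_mul_cancel (by simp) (by simp)]
        ring
    _ = _ := by
        simp only [hint]
        rfl

end IndependentKeys

section GlobalKey

theorem edgeSet_endpoints_nonempty {m : ℕ} {G : SimpleGraph (Fin m)} (e : G.edgeSet) :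
    {j | j ∈ (e : Sym2 (Fin m))}.Nonempty := by
  obtain ⟨e, he⟩ := e
  induction e using Sym2.ind with
  | _ a b => exact ⟨a, Sym2.mem_mk_left a b⟩

variable {m : ℕ} {G : SimpleGraph (Fin m)} [Fintype G.edgeSet] {𝒱 𝒵 : G.edgeSet → Type*}
  [∀ e, Countable (𝒱 e)] [∀ e, MeasurableSpace (𝒱 e)] [∀ e, DiscreteMeasurableSpace (𝒱 e)]
  [∀ e, Countable (𝒵 e)] [∀ e, MeasurableSpace (𝒵 e)] [∀ e, DiscreteMeasurableSpace (𝒵 e)]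

instance (S : PIN G 𝒱 𝒵) : IsProbabilityMeasure S.joint := by
  unfold PIN.joint; infer_instance

instance (S : PIN G 𝒱 𝒵) (n : ℕ) : IsProbabilityMeasure (S.iid n) := by
  unfold PIN.iid; infer_instance

/-- The samples of different edges are independent. -/
theorem PIN.measurePreserving_swap (S : PIN G 𝒱 𝒵) (n : ℕ) :
    MeasurePreserving (fun (ω : PIN.Sample 𝒱 𝒵 n) e t => ω t e) (S.iid n)
      (Measure.pi fun e => Measure.pi fun _ : Fin n => (S.edgeLaw e).toMeasure) := by
  refine ⟨.of_discrete, Measure.ext_of_singleton fun x => ?_⟩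
  rw [Measure.map_apply .of_discrete .of_discrete]
  have : (fun (ω : PIN.Sample 𝒱 𝒵 n) e t => ω t e) ⁻¹' {x} = {fun t e => x e t} := by
    ext ω
    simp only [Set.mem_preimage, Set.mem_singleton_iff, funext_iff]
    exact forall_comm
  rw [this, PIN.iid, Measure.pi_singleton, Measure.pi_singleton]
  simp only [PIN.joint, Measure.pi_singleton]
  exact Finset.prod_comm

theorem isSecretKey_iff_nearUniform {Ω ι κ Φ ζ : Type*} [MeasurableSpace Ω]
    [DiscreteMeasurableSpace Ω] {μ : Measure Ω} [IsProbabilityMeasure μ] [Fintype κ] [Nonempty κ]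
    [Countable Φ] [Countable ζ] {A : Set ι} {K : Ω → κ} {F : Ω → Φ} {Z : Ω → ζ} {out : ι → Ω → κ}
    (hout : ∀ j ω, out j ω = K ω) (hA : A.Nonempty) {ε σ : ℝ} :
    IsSecretKey μ A out K F Z ε σ ↔
      0 ≤ ε ∧ 0 ≤ σ ∧ NearUniform μ K (fun ω => (F ω, Z ω)) (ENNReal.ofReal σ) := by
  have h1 : (∀ j ∈ A, 1 - ε ≤ μ.real {ω | out j ω = K ω}) ↔ 0 ≤ ε := by
    obtain ⟨j, hj⟩ := hA
    simp only [hout, Set.ofPred_true, probReal_univ]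
    exact ⟨fun h => by linarith [h j hj], fun h _ _ => by linarith⟩
  rw [IsSecretKey, h1]
  refine and_congr_right fun _ => ⟨fun h => ?_, fun h => ?_⟩
  · have hσ := (statDist_nonneg _ _).trans h
    exact ⟨hσ, (statDist_le_iff_nearUniform K _ hσ).1 h⟩
  · exact (statDist_le_iff_nearUniform K _ h.1).2 h.2

/-- Truncation of bit strings as a group homomorphism. -/
def truncHom {ℓ L : ℕ} (h : L ≤ ℓ) : Bits ℓ →+ Bits L where
  toFun := truncBits h
  map_zero' := rfl
  map_add' _ _ := rfl

theorem truncHom_surjective {ℓ L : ℕ} (h : L ≤ ℓ) : Function.Surjective (truncHom h) := by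
  intro t
  refine ⟨fun i => if hi : (i : ℕ) < L then t ⟨i, hi⟩ else 0, ?_⟩
  funext i
  change (if hi : (i : ℕ) < L then t ⟨i, hi⟩ else 0) = t i
  simp

theorem PairwiseKeys.isGlobalSecret {n : ℕ} (𝒦 : PairwiseKeys 𝒱 n) (S : PIN G 𝒱 𝒵) (hG : G.IsTree)
    {r s : Fin m} (hrs : IsPendant G r s) {L : ℕ} (hL : ∀ e, L ≤ 𝒦.len e) {ε σ : ℝ}
    (h : ∀ e, 𝒦.IsPairSecret S e ε σ) :
    𝒦.IsGlobalSecret S hG r s hL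
      (Fintype.card G.edgeSet * ε) (2 * Fintype.card G.edgeSet * σ) := by
  have hadj : G.Adj r s := (hrs s).2 rfl
  have hcomm := 𝒦.finite_comm
  have hmsg := (𝒦.treeProtocol hG r s hL).finite_msg
  have h' : ∀ e, 0 ≤ ε ∧ 0 ≤ σ ∧ NearUniform (S.iid n) (fun ω => 𝒦.ext e (PIN.edgeVar ω e))
      (fun ω => ((fun j => 𝒦.comm e j (PIN.edgeVar ω e)), PIN.eve ω)) (ENNReal.ofReal σ) :=
    fun e => (isSecretKey_iff_nearUniform (K := fun ω => 𝒦.ext e (PIN.edgeVar ω e))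
      (fun _ _ => rfl) (edgeSet_endpoints_nonempty e)).1 (h e)
  obtain ⟨hε, hσ, -⟩ := h' ⟨s(r, s), hadj⟩
  refine (isSecretKey_iff_nearUniform (fun j ω => 𝒦.output_treeProtocol hL hG hrs ω j)
    ⟨r, Set.mem_univ r⟩).2 ⟨by positivity, by positivity, ?_⟩
  let X : G.edgeSet → Type _ := fun e => Fin n → 𝒱 e × 𝒵 e
  let μ : ∀ e, Measure (X e) := fun e => Measure.pi fun _ => (S.edgeLaw e).toMeasure
  let k : ∀ e, X e → Bits L := fun e x => truncBits (hL e) (𝒦.ext e fun t => (x t).1)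
  let η : G.edgeSet → Type _ := fun e =>
    ({j // j ∈ (e : Sym2 (Fin m))} → 𝒦.Comm e) × (Fin n → 𝒵 e)
  let y : ∀ e, X e → η e := fun e x => (fun j => 𝒦.comm e j fun t => (x t).1, fun t => (x t).2)
  have hswap := S.measurePreserving_swap n
  have hloc : ∀ e, NearUniform (μ e) (k e) (y e) (ENNReal.ofReal σ) := by
    intro e f hf
    have h1 := ((h' e).2.2.map_hom (truncHom (hL e)) (truncHom_surjective (hL e))).comp
      (fun q : ({j // j ∈ (e : Sym2 (Fin m))} → 𝒦.Comm e) × (Fin n → ∀ e, 𝒵 e) =>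
        ((q.1, fun t => q.2 t e) : η e)) f hf
    have hev : ∀ F : X e → ℝ≥0∞, ∫⁻ x, F x ∂μ e = ∫⁻ ω, F (fun t => ω t e) ∂S.iid n := by
      intro F
      rw [← (measurePreserving_eval μ e).lintegral_comp .of_discrete,
        ← hswap.lintegral_comp .of_discrete]
    simp only [hev]
    exact h1
  let T : (G.edgeSet → Bits L) → ∀ j, {i // G.Adj j i ∧ i ≠ towards G r j} → Bits L :=
    fun u j i => u ⟨s(j, towards G r j), adj_towards hG hrs j⟩ + u ⟨s(j, i), i.2.1⟩
  have hT : ∀ u c, T (fun e => u e + c) = T u := by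
    intro u c
    funext j i
    simp only [T]
    rw [add_add_add_comm, bits_add_self, add_zero]
  have hmain := nearUniform_pi μ k y hloc ⟨s(r, s), hadj⟩ T hT
  let φ : (∀ j, {i // G.Adj j i ∧ i ≠ towards G r j} → Bits L) × (∀ e, η e) →
      (∀ j, (𝒦.treeProtocol hG r s hL).Msg j) × (Fin n → ∀ e, 𝒵 e) := fun q =>
    (fun j => (fun e => (q.2 e.1).1 ⟨j, e.2⟩, q.1 j), fun t e => (q.2 e).2 t)
  have hfin := hmain.comp φ
  have hφ : ∀ ω : PIN.Sample 𝒱 𝒵 n,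
      ((𝒦.treeProtocol hG r s hL).transcript (PIN.obs ω), PIN.eve ω) =
      φ (T fun e => k e (fun t => ω t e), fun e => y e (fun t => ω t e)) := by
    intro ω
    refine Prod.ext (funext fun j => Prod.ext rfl (funext fun i => ?_)) rfl
    simp only [φ, T, NonInteractiveProtocol.transcript, PairwiseKeys.treeProtocol]
    rw [𝒦.localKey_eq hL (adj_towards hG hrs j), 𝒦.localKey_eq hL i.2.1]
    rfl
  have hcast : ENNReal.ofReal (2 * Fintype.card G.edgeSet * σ) =
      2 * Fintype.card G.edgeSet * ENNReal.ofReal σ := by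
    rw [ENNReal.ofReal_mul (by positivity), ENNReal.ofReal_mul (by norm_num)]
    simp
  rw [hcast]
  have hpull : ∀ F : (∀ e, X e) → ℝ≥0∞,
      ∫⁻ x, F x ∂Measure.pi μ = ∫⁻ ω, F (fun e t => ω t e) ∂S.iid n :=
    fun F => (hswap.lintegral_comp .of_discrete).symm
  intro f hf
  have h2 := hfin f hf
  simp only [hpull, ← hφ] at h2
  simp only [𝒦.localKey_eq hL hadj]
  exact h2

end GlobalKey

/-! ### Leftover hashing -/

section RandomHash

/-- The values of a uniformly random function at two distinct points are independent. -/
theorem sum_fun_mul_eq_zero {A κ : Type*} [Fintype A] [DecidableEq A] [AddCommGroup κ] [Fintype κ]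
    {a b : A} (hab : a ≠ b) (u v : κ → ℝ) (hu : ∑ k, u k = 0) :
    ∑ f : A → κ, u (f a) * v (f b) = 0 := by
  have h1 : ∀ c : κ, ∑ f : A → κ, u (f a + c) * v (f b) = ∑ f : A → κ, u (f a) * v (f b) := by
    intro c
    rw [← Equiv.sum_comp (Equiv.addRight (Pi.single a c : A → κ))
      fun f : A → κ => u (f a) * v (f b)]
    simp [Pi.single_eq_of_ne hab.symm]
  have h2 : ∑ c : κ, ∑ f : A → κ, u (f a + c) * v (f b) = 0 := by
    rw [Finset.sum_comm]
    refine Finset.sum_eq_zero fun f _ => ?_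
    rw [← Finset.sum_mul, show ∑ c, u (f a + c) = 0 from
      (Equiv.sum_comp (Equiv.addLeft (f a)) u).trans hu, zero_mul]
  simp only [h1, Finset.sum_const, Finset.card_univ, nsmul_eq_mul] at h2
  exact (mul_eq_zero.1 h2).resolve_left (by simp)

variable {α β κ : Type*} [AddCommGroup κ] [Fintype κ]

/-- The deviation of the indicator of `c = k` from its mean over the uniform `c`. -/
noncomputable def indicatorDev [DecidableEq κ] (k c : κ) : ℝ :=
  (if c = k then 1 else 0) - (Fintype.card κ : ℝ)⁻¹

theorem sum_indicatorDev_right [DecidableEq κ] (k : κ) : ∑ c, indicatorDev k c = 0 := by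
  simp [indicatorDev]

theorem sum_indicatorDev_sq_le [DecidableEq κ] (c : κ) : ∑ k, indicatorDev k c ^ 2 ≤ 1 := by
  have hK : (0 : ℝ) < Fintype.card κ := by positivity
  have : ∀ k, indicatorDev k c ^ 2 = (if c = k then 1 - 2 * (Fintype.card κ : ℝ)⁻¹ else 0) +
      (Fintype.card κ : ℝ)⁻¹ ^ 2 := by
    intro k
    unfold indicatorDev
    split_ifs <;> ring
  simp only [this, Finset.sum_add_distrib, Finset.sum_ite_eq, Finset.mem_univ, if_true,
    Finset.sum_const, Finset.card_univ, nsmul_eq_mul]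
  have h2 : (Fintype.card κ : ℝ) * (Fintype.card κ : ℝ)⁻¹ ^ 2 = (Fintype.card κ : ℝ)⁻¹ := by
    field_simp
  rw [h2]
  have : 0 ≤ (Fintype.card κ : ℝ)⁻¹ := by positivity
  linarith

/-- Second moment of a random hash function. If the weights `p` on the finite set `T` satisfy
`p (x, y) ≤ θ * q y`, then some function `f` has a small `q`-weighted square deviation of the
weights of its fibres from uniformity. -/
theorem exists_hash_second_moment [DecidableEq β] [DecidableEq κ] (T : Finset (α × β))
    (p : α × β → ℝ) (q : β → ℝ)
    {θ : ℝ} (hp : ∀ w ∈ T, 0 ≤ p w) (hq : ∀ w ∈ T, 0 < q w.2)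
    (hθ0 : 0 ≤ θ) (hθ : ∀ w ∈ T, p w ≤ θ * q w.2) (hp1 : ∑ w ∈ T, p w ≤ 1) :
    ∃ f : α → κ, ∑ y ∈ T.image Prod.snd, ∑ k : κ,
      (∑ w ∈ T with w.2 = y, p w * indicatorDev k (f w.1)) ^ 2 / q y ≤ θ := by
  classical
  let A := {x // x ∈ T.image Prod.fst}
  let ext : (A → κ) → α → κ := fun f x => if h : x ∈ T.image Prod.fst then f ⟨x, h⟩ else 0
  let V : (A → κ) → ℝ := fun f => ∑ y ∈ T.image Prod.snd, ∑ k : κ,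
      (∑ w ∈ T with w.2 = y, p w * indicatorDev k (ext f w.1)) ^ 2 / q y
  have hext : ∀ (f : A → κ) (w : α × β) (hw : w ∈ T),
      ext f w.1 = f ⟨w.1, Finset.mem_image_of_mem _ hw⟩ := by
    intro f w hw
    simp only [ext]
    rw [dif_pos (Finset.mem_image_of_mem _ hw)]
  have hqy : ∀ y ∈ T.image Prod.snd, 0 < q y := by
    intro y hy
    obtain ⟨w, hw, rfl⟩ := Finset.mem_image.1 hy
    exact hq w hw
  have hinner : ∀ y ∈ T.image Prod.snd,
      ∑ f : A → κ, ∑ k : κ, (∑ w ∈ T with w.2 = y, p w * indicatorDev k (ext f w.1)) ^ 2 ≤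
        Fintype.card (A → κ) * ∑ w ∈ T with w.2 = y, p w ^ 2 := by
    intro y _
    have hk : ∀ k : κ,
        ∑ f : A → κ, (∑ w ∈ T with w.2 = y, p w * indicatorDev k (ext f w.1)) ^ 2 =
        ∑ w ∈ T with w.2 = y, ∑ f : A → κ, p w ^ 2 * indicatorDev k (ext f w.1) ^ 2 := by
      intro k
      simp only [sq (∑ w ∈ T with w.2 = y, _), Finset.sum_mul_sum]
      rw [Finset.sum_comm]
      refine Finset.sum_congr rfl fun w hw => ?_
      rw [Finset.sum_comm, Finset.sum_eq_single_of_mem w hw]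
      · exact Finset.sum_congr rfl fun f _ => by ring
      · -- Off-diagonal terms average to zero: two points of `T` with the same `y` differ in `x`.
        intro w' hw' hne
        rw [Finset.mem_filter] at hw hw'
        have hne1 : w.1 ≠ w'.1 := fun h => hne (Prod.ext h.symm (hw'.2.trans hw.2.symm))
        simp only [hext _ w hw.1, hext _ w' hw'.1]
        have h0 := sum_fun_mul_eq_zero (A := A) (a := ⟨w.1, Finset.mem_image_of_mem _ hw.1⟩)
          (b := ⟨w'.1, Finset.mem_image_of_mem _ hw'.1⟩)
          (fun h => hne1 (congrArg Subtype.val h)) (indicatorDev k) (indicatorDev k)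
          (sum_indicatorDev_right k)
        calc _ = ∑ f : A → κ, p w * p w' * (indicatorDev k (f ⟨w.1, _⟩) *
              indicatorDev k (f ⟨w'.1, _⟩)) := Finset.sum_congr rfl fun f _ => by ring
          _ = 0 := by rw [← Finset.mul_sum, h0, mul_zero]
    rw [Finset.sum_comm]
    simp only [hk]
    rw [Finset.sum_comm, Finset.mul_sum]
    refine Finset.sum_le_sum fun w hw => ?_
    rw [Finset.sum_comm]
    calc ∑ f : A → κ, ∑ k, p w ^ 2 * indicatorDev k (ext f w.1) ^ 2
        = ∑ f : A → κ, p w ^ 2 * ∑ k, indicatorDev k (ext f w.1) ^ 2 := by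
          simp only [Finset.mul_sum]
      _ ≤ ∑ _f : A → κ, p w ^ 2 * 1 := by
          refine Finset.sum_le_sum fun f _ => ?_
          gcongr
          exact sum_indicatorDev_sq_le _
      _ = _ := by simp
  have hV : ∑ f, V f ≤ ∑ _f : A → κ, θ := by
    calc ∑ f, V f = ∑ y ∈ T.image Prod.snd, (∑ f : A → κ, ∑ k : κ,
          (∑ w ∈ T with w.2 = y, p w * indicatorDev k (ext f w.1)) ^ 2) / q y := by
          simp only [V]
          rw [Finset.sum_comm]
          simp only [Finset.sum_div]
      _ ≤ ∑ y ∈ T.image Prod.snd,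
          (Fintype.card (A → κ) * ∑ w ∈ T with w.2 = y, p w ^ 2) / q y := by
          refine Finset.sum_le_sum fun y hy => ?_
          have := hqy y hy
          gcongr
          exact hinner y hy
      _ ≤ ∑ y ∈ T.image Prod.snd, Fintype.card (A → κ) * (θ * ∑ w ∈ T with w.2 = y, p w) := by
          refine Finset.sum_le_sum fun y hy => ?_
          rw [mul_div_assoc]
          gcongr
          rw [div_le_iff₀ (hqy y hy), Finset.mul_sum, Finset.sum_mul]
          refine Finset.sum_le_sum fun w hw => ?_
          rw [Finset.mem_filter] at hw
          rw [← hw.2]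
          nlinarith [hp w hw.1, hθ w hw.1]
      _ = Fintype.card (A → κ) * (θ * ∑ w ∈ T, p w) := by
          rw [← Finset.mul_sum, ← Finset.mul_sum,
            Finset.sum_fiberwise_of_maps_to fun w hw => Finset.mem_image_of_mem _ hw]
      _ ≤ Fintype.card (A → κ) * (θ * 1) := by gcongr
      _ = _ := by simp
  obtain ⟨f, -, hf⟩ := Finset.exists_le_of_sum_le Finset.univ_nonempty hV
  exact ⟨ext f, hf⟩

/-- Leftover hashing on a finite set: the key `f x` is close to uniform given `y`, in the sense of
all test functions `g`. -/
theorem exists_hash (T : Finset (α × β)) (p : α × β → ℝ) (q : β → ℝ)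
    {θ : ℝ} (hp : ∀ w ∈ T, 0 ≤ p w) (hq : ∀ w ∈ T, 0 < q w.2)
    (hθ0 : 0 ≤ θ) (hθ : ∀ w ∈ T, p w ≤ θ * q w.2) (hp1 : ∑ w ∈ T, p w ≤ 1)
    (hq1 : ∀ B : Finset β, ∑ y ∈ B, q y ≤ 1) :
    ∃ f : α → κ, ∀ g : κ → β → ℝ, (∀ k y, 0 ≤ g k y) → (∀ k y, g k y ≤ 1) →
      ∑ w ∈ T, p w * g (f w.1) w.2 ≤
        ∑ w ∈ T, p w * ((Fintype.card κ : ℝ)⁻¹ * ∑ k, g k w.2) +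
          √(Fintype.card κ * θ) := by
  classical
  obtain ⟨f, hf⟩ := exists_hash_second_moment (κ := κ) T p q hp hq hθ0 hθ hp1
  refine ⟨f, fun g hg0 hg1 => ?_⟩
  have hK : (0 : ℝ) < Fintype.card κ := by positivity
  have hqy : ∀ y ∈ T.image Prod.snd, 0 < q y := by
    intro y hy
    obtain ⟨w, hw, rfl⟩ := Finset.mem_image.1 hy
    exact hq w hw
  set a : β → κ → ℝ := fun y k => ∑ w ∈ T with w.2 = y, p w * indicatorDev k (f w.1) with ha
  have hdiff : ∑ w ∈ T, p w * g (f w.1) w.2 -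
      ∑ w ∈ T, p w * ((Fintype.card κ : ℝ)⁻¹ * ∑ k, g k w.2) =
      ∑ z ∈ T.image Prod.snd ×ˢ (Finset.univ : Finset κ), g z.2 z.1 * a z.1 z.2 := by
    rw [Finset.sum_product, ← Finset.sum_sub_distrib,
      ← Finset.sum_fiberwise_of_maps_to (g := Prod.snd) (t := T.image Prod.snd)
        fun w hw => Finset.mem_image_of_mem _ hw]
    refine Finset.sum_congr rfl fun y _ => ?_
    simp only [ha, Finset.mul_sum]
    rw [Finset.sum_comm]
    refine Finset.sum_congr rfl fun w hw => ?_
    rw [(Finset.mem_filter.1 hw).2]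
    simp only [indicatorDev, mul_sub, Finset.sum_sub_distrib, mul_ite, mul_one, mul_zero,
      Finset.sum_ite_eq, Finset.mem_univ, if_true]
    congr 1
    · ring
    · exact Finset.sum_congr rfl fun k _ => by ring
  rw [← sub_le_iff_le_add', hdiff]
  apply Real.le_sqrt_of_sq_le
  have hCS := Finset.sum_sq_le_sum_mul_sum_of_sq_le_mul
    (T.image Prod.snd ×ˢ (Finset.univ : Finset κ))
    (r := fun z => g z.2 z.1 * a z.1 z.2) (f := fun z => q z.1 * (Fintype.card κ : ℝ)⁻¹)
    (g := fun z => Fintype.card κ * (a z.1 z.2 ^ 2 / q z.1))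
    (fun z hz => by
      have := hqy z.1 (Finset.mem_product.1 hz).1
      positivity)
    (fun z hz => by
      have := hqy z.1 (Finset.mem_product.1 hz).1
      positivity)
    (fun z hz => by
      have h0 := hqy z.1 (Finset.mem_product.1 hz).1
      have h1 : g z.2 z.1 ^ 2 ≤ 1 := pow_le_one₀ (hg0 _ _) (hg1 _ _)
      calc (g z.2 z.1 * a z.1 z.2) ^ 2 = g z.2 z.1 ^ 2 * a z.1 z.2 ^ 2 := by ring
        _ ≤ 1 * a z.1 z.2 ^ 2 := by gcongr
        _ = _ := by field_simp)
  -- Cauchy-Schwarz with the weights `q y / |κ|`, which sum to at most `1`.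
  refine hCS.trans ?_
  have h1 : ∑ z ∈ T.image Prod.snd ×ˢ (Finset.univ : Finset κ),
      q z.1 * (Fintype.card κ : ℝ)⁻¹ ≤ 1 := by
    rw [Finset.sum_product]
    simp only [Finset.sum_const, Finset.card_univ, nsmul_eq_mul]
    refine le_trans (le_of_eq (Finset.sum_congr rfl fun y _ => ?_)) (hq1 (T.image Prod.snd))
    field_simp
  have h2 : ∑ z ∈ T.image Prod.snd ×ˢ (Finset.univ : Finset κ),
      Fintype.card κ * (a z.1 z.2 ^ 2 / q z.1) ≤ Fintype.card κ * θ := by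
    rw [← Finset.mul_sum, Finset.sum_product]
    gcongr
  calc _ ≤ 1 * (Fintype.card κ * θ) := by
        gcongr
        refine Finset.sum_nonneg fun z hz => ?_
        have := hqy z.1 (Finset.mem_product.1 hz).1
        positivity
    _ = _ := one_mul _

theorem massFn_pair_le {Ω : Type*} [MeasurableSpace Ω] {μ : Measure Ω} [IsFiniteMeasure μ]
    (W : Ω → α) (Y : Ω → β) (w : α × β) :
    massFn μ (fun ω => (W ω, Y ω)) w ≤ massFn μ Y w.2 :=
  measureReal_mono fun ω (hω : (W ω, Y ω) = w) => congrArg Prod.snd hω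

/-- Leftover hashing: if with high probability the conditional probability of `W` given `Y` is at
most `θ`, then some function of `W` is a nearly uniform key given `Y`. -/
theorem exists_nearUniform_hash {Ω : Type*} [MeasurableSpace Ω] [DiscreteMeasurableSpace Ω]
    {μ : Measure Ω} [IsProbabilityMeasure μ] [Countable α] [Countable β] (W : Ω → α) (Y : Ω → β)
    {θ η : ℝ} (hθ0 : 0 ≤ θ) (hη : 0 < η)
    (hbad : μ.real {ω | θ * massFn μ Y (Y ω) < massFn μ (fun ω => (W ω, Y ω)) (W ω, Y ω)} ≤ η) :
    ∃ f : α → κ, NearUniform μ (fun ω => f (W ω)) Y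
      (ENNReal.ofReal (√(Fintype.card κ * θ) + 2 * η)) := by
  classical
  set p := massFn μ (fun ω => (W ω, Y ω)) with hpdef
  set q := massFn μ Y with hqdef
  have hps : HasSum p 1 := hasSum_massFn _
  have hqs : HasSum q 1 := hasSum_massFn _
  have hp0 : ∀ w, 0 ≤ p w := massFn_nonneg _
  have hpq : ∀ w, p w ≤ q w.2 := massFn_pair_le W Y
  obtain ⟨T₀, hT₀⟩ : ∃ T₀ : Finset (α × β), 1 - η < ∑ w ∈ T₀, p w :=
    ((hps.eventually (lt_mem_nhds (by linarith : 1 - η < 1)))).exists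
  let T := T₀.filter fun w => p w ≤ θ * q w.2 ∧ 0 < p w
  have hbadsum : ∑ w ∈ T₀ with ¬ (p w ≤ θ * q w.2 ∧ 0 < p w), p w ≤ η := by
    refine le_trans ?_ hbad
    let B := T₀.filter fun w => θ * q w.2 < p w
    have h1 : ∑ w ∈ T₀ with ¬ (p w ≤ θ * q w.2 ∧ 0 < p w), p w ≤ ∑ w ∈ B, p w := by
      rw [Finset.sum_filter, Finset.sum_filter]
      refine Finset.sum_le_sum fun w _ => ?_
      split_ifs with h2 h3 h3
      · exact hp0 w
      · exact le_rfl
      · exact le_rfl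
      · exact not_lt.1 fun h4 => h2 ⟨not_lt.1 h3, h4⟩
    refine h1.trans ?_
    have h2 : ∑ w ∈ B, p w = μ.real (⋃ w ∈ B, {ω | (W ω, Y ω) = w}) := by
      rw [measureReal_biUnion_finset ?_ fun _ _ => .of_discrete]
      · rfl
      · intro w _ w' _ hne
        rw [Function.onFun, Set.disjoint_left]
        intro ω h3 h4
        exact hne (h3.symm.trans h4)
    rw [h2]
    refine measureReal_mono fun ω hω => ?_
    simp only [Set.mem_iUnion] at hω
    obtain ⟨w, hw, h3⟩ := hω
    have h4 := (Finset.mem_filter.1 hw).2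
    rw [← show (W ω, Y ω) = w from h3] at h4
    exact h4
  have hTsum : 1 - 2 * η ≤ ∑ w ∈ T, p w := by
    have := Finset.sum_filter_add_sum_filter_not T₀ (fun w => p w ≤ θ * q w.2 ∧ 0 < p w) p
    simp only [T]
    linarith
  have hT : ∀ w ∈ T, p w ≤ θ * q w.2 ∧ 0 < p w := fun w hw => (Finset.mem_filter.1 hw).2
  obtain ⟨f, hf⟩ := exists_hash (κ := κ) T p q (fun w hw => hp0 w)
    (fun w hw => (hT w hw).2.trans_le (hpq w)) hθ0 (fun w hw => (hT w hw).1)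
    (sum_le_hasSum _ (fun w _ => hp0 w) hps)
    (fun B => sum_le_hasSum _ (fun w _ => massFn_nonneg _ _) hqs)
  refine ⟨f, fun g hg => ?_⟩
  have hgtop : ∀ k y, g k y ≠ ∞ := fun k y => ne_top_of_le_ne_top ENNReal.one_ne_top (hg k y)
  have hfin := hf (fun k y => (g k y).toReal) (fun _ _ => ENNReal.toReal_nonneg)
    (fun k y => ENNReal.toReal_le_of_le_ofReal zero_le_one (by simpa using hg k y))
  have hLHS : ∑ w ∈ T, g (f w.1) w.2 * ENNReal.ofReal (p w) =
      ENNReal.ofReal (∑ w ∈ T, p w * (g (f w.1) w.2).toReal) := by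
    rw [ENNReal.ofReal_sum_of_nonneg fun w _ => mul_nonneg (hp0 w) ENNReal.toReal_nonneg]
    refine Finset.sum_congr rfl fun w _ => ?_
    rw [ENNReal.ofReal_mul (hp0 w), ENNReal.ofReal_toReal (hgtop _ _), mul_comm]
  have hRHS : ENNReal.ofReal (∑ w ∈ T, p w * ((Fintype.card κ : ℝ)⁻¹ * ∑ k, (g k w.2).toReal)) =
      ∑ w ∈ T, ((Fintype.card κ : ℝ≥0∞)⁻¹ * ∑ k, g k w.2) * ENNReal.ofReal (p w) := by
    rw [ENNReal.ofReal_sum_of_nonneg fun w _ => mul_nonneg (hp0 w) (mul_nonneg (by positivity)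
      (Finset.sum_nonneg fun _ _ => ENNReal.toReal_nonneg))]
    refine Finset.sum_congr rfl fun w _ => ?_
    rw [ENNReal.ofReal_mul (hp0 w), ENNReal.ofReal_mul (by positivity),
      ENNReal.ofReal_sum_of_nonneg fun _ _ => ENNReal.toReal_nonneg,
      ENNReal.ofReal_inv_of_pos (by positivity), ENNReal.ofReal_natCast, mul_comm]
    simp only [ENNReal.ofReal_toReal (hgtop _ _)]
  have hunif : (Fintype.card κ : ℝ≥0∞)⁻¹ * ∑ k, ∫⁻ ω, g k (Y ω) ∂μ =
      ∑' w : α × β, ((Fintype.card κ : ℝ≥0∞)⁻¹ * ∑ k, g k w.2) * ENNReal.ofReal (p w) := by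
    rw [← lintegral_finsetSum _ fun _ _ => .of_discrete, ← lintegral_const_mul _ .of_discrete]
    exact lintegral_comp_eq_tsum (μ := μ) (fun ω => (W ω, Y ω))
      (fun w => (Fintype.card κ : ℝ≥0∞)⁻¹ * ∑ k, g k w.2)
  have htail : ∑' w, (if w ∈ T then 0 else ENNReal.ofReal (p w)) ≤ ENNReal.ofReal (2 * η) := by
    have h1 : ∑ w ∈ T, ENNReal.ofReal (p w) + ∑' w, (if w ∈ T then 0 else ENNReal.ofReal (p w)) =
        1 := by
      have h2 : ∑ w ∈ T, ENNReal.ofReal (p w) =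
          ∑' w, (if w ∈ T then ENNReal.ofReal (p w) else 0) := by
        rw [tsum_eq_sum (L := .unconditional _) (s := T) (fun w hw => if_neg hw)]
        exact Finset.sum_congr rfl fun w hw => (if_pos hw).symm
      rw [← tsum_ofReal_massFn (μ := μ) (fun ω => (W ω, Y ω)), ← hpdef, h2, ← ENNReal.tsum_add]
      refine tsum_congr fun w => ?_
      split_ifs <;> simp
    rw [← ENNReal.ofReal_sum_of_nonneg fun w _ => hp0 w] at h1
    rw [← ENNReal.add_le_add_iff_left (a := ENNReal.ofReal (∑ w ∈ T, p w)) (by simp), h1,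
      ← ENNReal.ofReal_add (Finset.sum_nonneg fun w _ => hp0 w) (by positivity),
      ← ENNReal.ofReal_one]
    exact ENNReal.ofReal_le_ofReal (by linarith)
  calc ∫⁻ ω, g (f (W ω)) (Y ω) ∂μ
      = ∑' w : α × β, g (f w.1) w.2 * ENNReal.ofReal (p w) :=
        lintegral_comp_eq_tsum (μ := μ) (fun ω => (W ω, Y ω)) (fun w => g (f w.1) w.2)
    _ ≤ ∑' w : α × β, ((if w ∈ T then g (f w.1) w.2 * ENNReal.ofReal (p w) else 0) +
          if w ∈ T then 0 else ENNReal.ofReal (p w)) := by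
        refine ENNReal.tsum_le_tsum fun w => ?_
        split_ifs
        · simp
        · rw [zero_add]
          exact mul_le_of_le_one_left' (hg _ _)
    _ = ∑ w ∈ T, g (f w.1) w.2 * ENNReal.ofReal (p w) +
          ∑' w, (if w ∈ T then 0 else ENNReal.ofReal (p w)) := by
        rw [ENNReal.tsum_add, tsum_eq_sum (L := .unconditional _) (s := T) (fun w hw => if_neg hw)]
        congr 1
        exact Finset.sum_congr rfl fun w hw => if_pos hw
    _ ≤ (∑ w ∈ T, ((Fintype.card κ : ℝ≥0∞)⁻¹ * ∑ k, g k w.2) * ENNReal.ofReal (p w) +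
          ENNReal.ofReal √(Fintype.card κ * θ)) + ENNReal.ofReal (2 * η) := by
        gcongr
        rw [hLHS, ← hRHS]
        exact (ENNReal.ofReal_le_ofReal hfin).trans ENNReal.ofReal_add_le
    _ ≤ _ := by
        rw [hunif, add_assoc, ← ENNReal.ofReal_add (by positivity) (by positivity)]
        gcongr
        exact ENNReal.sum_le_tsum T

end RandomHash

/-! ### Typical sets and extraction rates -/

section TypicalSets

variable {Ω α β : Type*} [MeasurableSpace Ω]

/-- The conditional information `log₂ (P(Y) / P(X, Y))` of `X` given `Y`, as a random variable. -/
noncomputable def condInfo (P : Measure Ω) (X : Ω → α) (Y : Ω → β) (ω : Ω) : ℝ :=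
  Real.logb 2 (massFn P Y (Y ω) / massFn P (fun ω => (X ω, Y ω)) (X ω, Y ω))

theorem condInfo_nonneg (P : Measure Ω) [IsFiniteMeasure P] (X : Ω → α) (Y : Ω → β) (ω : Ω) :
    0 ≤ condInfo P X Y ω := by
  have h0 : 0 ≤ massFn P (fun ω => (X ω, Y ω)) (X ω, Y ω) := massFn_nonneg _ _
  rcases h0.eq_or_lt with h | h
  · simp [condInfo, ← h]
  · refine Real.logb_nonneg (by norm_num) ?_
    rw [one_le_div h]
    exact massFn_pair_le X Y (X ω, Y ω)

theorem massFn_pi {P : Measure Ω} [SigmaFinite P] (X : Ω → α) {n : ℕ} (x : Fin n → α) :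
    massFn (Measure.pi fun _ : Fin n => P) (fun ω t => X (ω t)) x = ∏ t, massFn P X (x t) := by
  simp only [massFn, measureReal_def, ← ENNReal.toReal_prod]
  rw [← Measure.pi_pi]
  congr 2
  ext ω
  simp [funext_iff]

theorem massFn_pair_pi {P : Measure Ω} [SigmaFinite P] (X : Ω → α) (Y : Ω → β) {n : ℕ}
    (x : Fin n → α) (y : Fin n → β) :
    massFn (Measure.pi fun _ : Fin n => P) (fun ω => (fun t => X (ω t), fun t => Y (ω t))) (x, y) =
      ∏ t, massFn P (fun ω => (X ω, Y ω)) (x t, y t) := by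
  rw [← massFn_pi (fun ω => (X ω, Y ω)) fun t => (x t, y t)]
  simp only [massFn]
  congr 1
  ext ω
  simp [funext_iff, forall_and]

variable [DiscreteMeasurableSpace Ω] [Countable α] [Countable β]

theorem condEntropy_eq_lintegral (P : Measure Ω) [IsProbabilityMeasure P] (X : Ω → α) (Y : Ω → β) :
    condEntropy P X Y = ∫⁻ ω, ENNReal.ofReal (condInfo P X Y ω) ∂P := by
  have h := lintegral_comp_eq_tsum (μ := P) (fun ω => (X ω, Y ω)) (fun w => ENNReal.ofReal
    (Real.logb 2 (massFn P Y w.2 / massFn P (fun ω => (X ω, Y ω)) w)))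
  refine Eq.trans (tsum_congr fun w => ?_) h.symm
  rw [ENNReal.ofReal_mul (massFn_nonneg _ _), mul_comm]

variable [Countable Ω]

/-- The entropy, even if it is infinite, is the supremum of the means of the truncated conditional
information. -/
theorem exists_truncation (P : Measure Ω) [IsProbabilityMeasure P] (X : Ω → α) (Y : Ω → β) {R : ℝ}
    (hR : ENNReal.ofReal R < condEntropy P X Y) :
    ∃ M : ℕ, R < ∫ ω, min (condInfo P X Y ω) M ∂P := by
  have hsup : ∀ x : ℝ, ENNReal.ofReal x = ⨆ M : ℕ, ENNReal.ofReal (min x M) := by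
    intro x
    refine le_antisymm ?_ (iSup_le fun M => ENNReal.ofReal_le_ofReal (min_le_left _ _))
    obtain ⟨M, hM⟩ := exists_nat_ge x
    exact le_iSup_of_le M (by rw [min_eq_left hM])
  rw [condEntropy_eq_lintegral] at hR
  simp only [hsup (condInfo P X Y _)] at hR
  rw [lintegral_iSup (fun _ => .of_discrete), lt_iSup_iff] at hR
  · obtain ⟨M, hM⟩ := hR
    refine ⟨M, ?_⟩
    rw [← ofReal_integral_eq_lintegral_ofReal] at hM
    · exact (ENNReal.ofReal_lt_ofReal_iff').1 hM |>.1
    · refine Integrable.of_bound (C := M) .of_discrete (.of_forall fun ω => ?_)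
      rw [Real.norm_of_nonneg (le_min (condInfo_nonneg _ _ _ _) (by positivity))]
      exact min_le_right _ _
    · exact .of_forall fun ω => le_min (condInfo_nonneg _ _ _ _) (by positivity)
  · intro M N hMN ω
    exact ENNReal.ofReal_le_ofReal (min_le_min_left _ (by exact_mod_cast hMN))

variable {P : Measure Ω} [IsProbabilityMeasure P]

/-- Weak law of large numbers for a bounded function, as a bound on the lower tail. -/
theorem tendsto_measure_sum_le {J : Ω → ℝ} {M : ℝ} (hJ0 : ∀ ω, 0 ≤ J ω) (hJM : ∀ ω, J ω ≤ M)
    {R : ℝ} (hR : R < ∫ ω, J ω ∂P) :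
    Tendsto (fun n : ℕ => (Measure.pi fun _ : Fin n => P).real {ω | ∑ t, J (ω t) ≤ n * R})
      atTop (𝓝 0) := by
  set d := ∫ ω, J ω ∂P - R with hd
  have hdpos : 0 < d := sub_pos.2 hR
  have hmem : MemLp J 2 P := MemLp.of_bound .of_discrete M
    (.of_forall fun ω => by rw [Real.norm_of_nonneg (hJ0 ω)]; exact hJM ω)
  have hlim : Tendsto (fun n : ℕ => ProbabilityTheory.variance J P / d ^ 2 / (n : ℝ))
      atTop (𝓝 0) := tendsto_const_div_atTop_nhds_zero_nat _
  refine squeeze_zero' (.of_forall fun _ => measureReal_nonneg) ?_ hlim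
  filter_upwards [eventually_gt_atTop 0] with n hn
  have hn' : (0 : ℝ) < n := by exact_mod_cast hn
  have hvar := ProbabilityTheory.variance_sum_pi (μ := fun _ : Fin n => P) (X := fun _ => J)
    fun _ => hmem
  have hmemS : MemLp (∑ t, fun ω : Fin n → Ω => J (ω t)) 2 (Measure.pi fun _ : Fin n => P) :=
    memLp_finsetSum' _ fun t _ => hmem.comp_measurePreserving (measurePreserving_eval _ t)
  have hmean : ∫ ω, (∑ t, fun ω : Fin n → Ω => J (ω t)) ω ∂(Measure.pi fun _ : Fin n => P) =
      n * ∫ ω, J ω ∂P := by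
    simp only [Finset.sum_apply]
    rw [integral_finsetSum]
    · have : ∀ t : Fin n, ∫ ω, J (ω t) ∂(Measure.pi fun _ : Fin n => P) = ∫ ω, J ω ∂P :=
        fun t => integral_comp_eval (μ := fun _ : Fin n => P) (i := t) (f := J) .of_discrete
      simp [this]
    · intro t _
      exact (hmem.comp_measurePreserving (measurePreserving_eval (fun _ : Fin n => P) t)).integrable
        (by norm_num)
  have hcheb := ProbabilityTheory.meas_ge_le_variance_div_sq hmemS (mul_pos hn' hdpos)
  rw [hmean, hvar] at hcheb
  have hreal := ENNReal.toReal_mono ENNReal.ofReal_ne_top hcheb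
  have hv0 := ProbabilityTheory.variance_nonneg J P
  rw [ENNReal.toReal_ofReal (by simp only [Finset.sum_const]; positivity)] at hreal
  refine (measureReal_mono fun ω hω => ?_).trans (hreal.trans_eq ?_)
  · simp only [Set.mem_ofPred_eq, Finset.sum_apply] at hω ⊢
    rw [abs_sub_comm]
    refine le_trans ?_ (le_abs_self _)
    rw [hd]
    linarith
  · simp only [Finset.sum_const, Finset.card_univ, Fintype.card_fin, nsmul_eq_mul]
    field_simp

/-- Keys can be extracted at every rate below the conditional entropy. -/
theorem eventually_exists_extractor (X : Ω → α) (Y : Ω → β) {R : ℝ} (hR0 : 0 ≤ R)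
    (hR : ENNReal.ofReal R < condEntropy P X Y) {δ : ℝ} (hδ : 0 < δ) :
    ∀ᶠ n : ℕ in atTop, ∃ f : (Fin n → α) → Bits ⌊n * R⌋₊,
      NearUniform (Measure.pi fun _ : Fin n => P) (fun ω => f (fun t => X (ω t)))
        (fun ω t => Y (ω t)) (ENNReal.ofReal δ) := by
  obtain ⟨M, hM⟩ := exists_truncation P X Y hR
  obtain ⟨R', hRR', hR'⟩ := exists_between hM
  have htail := tendsto_measure_sum_le (P := P) (J := fun ω => min (condInfo P X Y ω) M) (M := M)
    (fun ω => le_min (condInfo_nonneg _ _ _ _) (by positivity)) (fun ω => min_le_right _ _) hR'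
  have hdecay : Tendsto (fun n : ℕ => √(((2 : ℝ) ^ (-(R' - R))) ^ n)) atTop (𝓝 0) := by
    have h1 := tendsto_pow_atTop_nhds_zero_of_lt_one (r := (2 : ℝ) ^ (-(R' - R))) (by positivity)
      (Real.rpow_lt_one_of_one_lt_of_neg (by norm_num) (by linarith))
    have h2 := (Real.continuous_sqrt.tendsto 0).comp h1
    rwa [Real.sqrt_zero] at h2
  filter_upwards [htail.eventually_le_const (show (0 : ℝ) < δ / 4 by positivity),
    hdecay.eventually_le_const (show (0 : ℝ) < δ / 2 by positivity)] with n hn1 hn2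
  have hθ0 : (0 : ℝ) ≤ 2 ^ (-(n * R')) := by positivity
  have hhash := exists_nearUniform_hash (κ := Bits ⌊n * R⌋₊)
    (μ := Measure.pi fun _ : Fin n => P) (fun ω t => X (ω t)) (fun ω t => Y (ω t)) hθ0
    (show (0 : ℝ) < δ / 4 by positivity)
  refine (hhash ?_).elim fun f hf => ?_
  swap
  · refine ⟨f, fun g hg => (hf g hg).trans ?_⟩
    gcongr
    have hcard : (Fintype.card (Bits ⌊n * R⌋₊) : ℝ) ≤ 2 ^ (n * R) := by
      simp only [Fintype.card_pi, ZMod.card, Finset.prod_const, Finset.card_univ, Fintype.card_fin]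
      push_cast
      rw [← Real.rpow_natCast]
      exact Real.rpow_le_rpow_of_exponent_le (by norm_num) (Nat.floor_le (by positivity))
    have h2 : (Fintype.card (Bits ⌊n * R⌋₊) : ℝ) * 2 ^ (-(n * R')) ≤
        ((2 : ℝ) ^ (-(R' - R))) ^ n := by
      calc _ ≤ (2 : ℝ) ^ (n * R) * 2 ^ (-(n * R')) := by gcongr
        _ = _ := by
          rw [← Real.rpow_add (by norm_num), ← Real.rpow_natCast, ← Real.rpow_mul (by norm_num)]
          congr 1
          ring
    have := Real.sqrt_le_sqrt h2
    linarith
  · -- A sequence with large conditional probability has small total conditional information.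
    refine le_trans (measureReal_mono fun ω hω => ?_) hn1
    simp only [Set.mem_ofPred_eq] at hω ⊢
    rw [massFn_pi, massFn_pair_pi] at hω
    set q := fun t => massFn P Y (Y (ω t)) with hq
    set p := fun t => massFn P (fun ω => (X ω, Y ω)) (X (ω t), Y (ω t)) with hp
    have hq0 : ∀ t, 0 ≤ q t := fun t => massFn_nonneg _ _
    have hprod : 0 < ∏ t, p t :=
      (mul_nonneg hθ0 (Finset.prod_nonneg fun t _ => hq0 t)).trans_lt hω
    have hp0 : ∀ t, 0 < p t := fun t =>
      (massFn_nonneg _ _).lt_of_ne' fun h =>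
        hprod.ne' (Finset.prod_eq_zero (Finset.mem_univ t) h)
    have hqpos : ∀ t, 0 < q t := fun t => (hp0 t).trans_le (massFn_pair_le X Y (X (ω t), Y (ω t)))
    have hinfo : ∑ t, condInfo P X Y (ω t) = Real.logb 2 ((∏ t, q t) / ∏ t, p t) := by
      rw [← Finset.prod_div_distrib, Real.logb_prod _ _ fun t _ => (div_pos (hqpos t) (hp0 t)).ne']
      rfl
    calc ∑ t, min (condInfo P X Y (ω t)) M ≤ ∑ t, condInfo P X Y (ω t) :=
          Finset.sum_le_sum fun t _ => min_le_left _ _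
      _ ≤ n * R' := by
          rw [hinfo, Real.logb_le_iff_le_rpow (by norm_num)
            (div_pos (Finset.prod_pos fun t _ => hqpos t) hprod), div_le_iff₀ hprod]
          have h3 : (2 : ℝ) ^ (n * R') * 2 ^ (-(n * R')) = 1 := by
            rw [← Real.rpow_add (by norm_num)]; simp
          calc ∏ t, q t = 2 ^ (n * R') * (2 ^ (-(n * R')) * ∏ t, q t) := by
                rw [← mul_assoc, h3, one_mul]
            _ ≤ _ := by gcongr

end TypicalSets

/-! ### Choice of the rates -/

section Rates

theorem nearUniform_of_subsingleton {Ω κ η : Type*} [MeasurableSpace Ω] {μ : Measure Ω} [Fintype κ]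
    [Nonempty κ] [Subsingleton κ] (K : Ω → κ) (Y : Ω → η) (δ : ℝ≥0∞) : NearUniform μ K Y δ := by
  intro f _
  have k₀ : κ := Classical.arbitrary κ
  have hcard : Fintype.card κ = 1 := Fintype.card_eq_one_iff.2 ⟨k₀, fun k => Subsingleton.elim _ _⟩
  rw [Fintype.sum_eq_single k₀ fun k hk => absurd (Subsingleton.elim _ _) hk, hcard]
  simp only [Nat.cast_one, inv_one, one_mul, Subsingleton.elim (K _) k₀]
  exact le_self_add

/-- Rates below `H` (or `0`) converging to `H`, the first of which is `0`. -/
theorem exists_rates (H : ℝ≥0∞) : ∃ R : ℕ → ℝ, R 0 = 0 ∧ (∀ k, 0 ≤ R k) ∧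
    (∀ k, R k = 0 ∨ ENNReal.ofReal (R k) < H) ∧
    Tendsto (fun k => ENNReal.ofReal (R k)) atTop (𝓝 H) := by
  rcases eq_or_ne H 0 with rfl | hH
  · exact ⟨fun _ => 0, rfl, fun _ => le_rfl, fun _ => .inl rfl, by simp⟩
  · obtain ⟨u, -, hu, hlim⟩ := exists_seq_strictMono_tendsto' (pos_iff_ne_zero.2 hH)
    have htop : ∀ k, u k ≠ ∞ := fun k => (hu k).2.ne_top
    refine ⟨fun k => if k = 0 then 0 else (u k).toReal, rfl, fun k => ?_, fun k => ?_, ?_⟩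
    · dsimp only
      split_ifs <;> simp
    · rcases eq_or_ne k 0 with rfl | hk
      · exact .inl rfl
      · right
        simpa [hk, ENNReal.ofReal_toReal (htop k)] using (hu k).2
    · refine hlim.congr' ?_
      filter_upwards [eventually_ne_atTop 0] with k hk
      simp [hk, ENNReal.ofReal_toReal (htop k)]

/-- A diagonal choice: properties which hold eventually for each `k` hold for all `n` with
some `κ n → ∞`, if the property for `k = 0` holds for all `n`. -/
theorem exists_diagonal {p : ℕ → ℕ → Prop} (h0 : ∀ n, p 0 n) (h : ∀ k, ∀ᶠ n in atTop, p k n) :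
    ∃ κ : ℕ → ℕ, (∀ n, p (κ n) n) ∧ Tendsto κ atTop atTop := by
  classical
  refine ⟨fun n => Nat.findGreatest (fun k => p k n) n,
    fun n => Nat.findGreatest_spec (P := fun k => p k n) (Nat.zero_le n) (h0 n),
    tendsto_atTop.2 fun k => ?_⟩
  filter_upwards [h k, eventually_ge_atTop k] with n hn hkn
  exact Nat.le_findGreatest hkn hn

theorem tendsto_floor_rate {r : ℕ → ℝ} (hr : ∀ n, 0 ≤ r n) {H : ℝ≥0∞}
    (h : Tendsto (fun n => ENNReal.ofReal (r n)) atTop (𝓝 H)) :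
    Tendsto (fun n : ℕ => ((⌊n * r n⌋₊ : ℕ) : ℝ≥0∞) / (n : ℝ≥0∞)) atTop (𝓝 H) := by
  have hlow : Tendsto (fun n : ℕ => ENNReal.ofReal (r n) - ENNReal.ofReal (1 / (n : ℝ)))
      atTop (𝓝 H) := by
    have h1 : Tendsto (fun n : ℕ => ENNReal.ofReal (1 / (n : ℝ))) atTop (𝓝 0) := by
      simpa using ENNReal.tendsto_ofReal tendsto_one_div_atTop_nhds_zero_nat
    simpa using ENNReal.Tendsto.sub h h1 (.inr ENNReal.zero_ne_top)
  have hcast : ∀ n : ℕ, 0 < n → ((⌊n * r n⌋₊ : ℕ) : ℝ≥0∞) / (n : ℝ≥0∞) =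
      ENNReal.ofReal (⌊n * r n⌋₊ / n) := by
    intro n hn
    rw [ENNReal.ofReal_div_of_pos (by positivity), ENNReal.ofReal_natCast, ENNReal.ofReal_natCast]
  refine tendsto_of_tendsto_of_tendsto_of_le_of_le' hlow h ?_ ?_
  · filter_upwards [eventually_gt_atTop 0] with n hn
    have hn' : (0 : ℝ) < n := by exact_mod_cast hn
    rw [hcast n hn, ← ENNReal.ofReal_sub _ (by positivity)]
    refine ENNReal.ofReal_le_ofReal ?_
    rw [le_div_iff₀ hn', sub_mul, one_div, inv_mul_cancel₀ hn'.ne', mul_comm]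
    linarith [Nat.lt_floor_add_one ((n : ℝ) * r n)]
  · filter_upwards [eventually_gt_atTop 0] with n hn
    have hn' : (0 : ℝ) < n := by exact_mod_cast hn
    rw [hcast n hn]
    refine ENNReal.ofReal_le_ofReal ?_
    rw [div_le_iff₀ hn', mul_comm (r n)]
    exact Nat.floor_le (mul_nonneg hn'.le (hr n))

end Rates

/-- Pairwise keys of rates tending to the least conditional entropy of an edge exist, even without
any pairwise communication. -/
theorem exists_pairwiseKeys {m : ℕ} {G : SimpleGraph (Fin m)} [Fintype G.edgeSet]
    {𝒱 𝒵 : G.edgeSet → Type*}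
    [∀ e, Countable (𝒱 e)] [∀ e, MeasurableSpace (𝒱 e)] [∀ e, DiscreteMeasurableSpace (𝒱 e)]
    [∀ e, Countable (𝒵 e)] [∀ e, MeasurableSpace (𝒵 e)] [∀ e, DiscreteMeasurableSpace (𝒵 e)]
    (S : PIN G 𝒱 𝒵) :
    ∃ (𝒦 : ∀ n : ℕ, PairwiseKeys 𝒱 n) (L : ℕ → ℕ) (δ : ℕ → ℝ), (∀ n e, L n ≤ (𝒦 n).len e) ∧
      (∀ n, 0 < δ n) ∧ Tendsto δ atTop (𝓝 0) ∧ (∀ n e, (𝒦 n).IsPairSecret S e (δ n) (δ n)) ∧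
      Tendsto (fun n : ℕ => (L n : ℝ≥0∞) / (n : ℝ≥0∞)) atTop (𝓝 (⨅ e, S.edgeEntropy e)) := by
  obtain ⟨R, hR0, hRnn, hRlt, hRlim⟩ := exists_rates (⨅ e, S.edgeEntropy e)
  let p : ℕ → ℕ → Prop := fun k n => ∀ e, ∃ f : (Fin n → 𝒱 e) → Bits ⌊n * R k⌋₊,
    NearUniform (S.iid n) (fun ω => f (PIN.edgeVar ω e)) PIN.eve (ENNReal.ofReal (1 / (k + 1)))
  have hzero : ∀ k n, R k = 0 → p k n := by
    intro k n hk e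
    have hlen : ⌊n * R k⌋₊ = 0 := by simp [hk]
    have : IsEmpty (Fin ⌊n * R k⌋₊) := by rw [hlen]; infer_instance
    exact ⟨fun _ => 0, nearUniform_of_subsingleton _ _ _⟩
  obtain ⟨κ, hκ, hκlim⟩ := exists_diagonal (p := p) (fun n => hzero 0 n hR0) (by
    intro k
    rcases hRlt k with hk | hk
    · exact .of_forall fun n => hzero k n hk
    · exact eventually_all.2 fun e => eventually_exists_extractor (P := S.joint)
        (fun ω => (ω e).1) (fun ω e' => (ω e').2) (hRnn k) (hk.trans_le (iInf_le _ e))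
        (by positivity))
  choose f hf using hκ
  refine ⟨fun n =>
    { len := fun _ => ⌊n * R (κ n)⌋₊
      ext := fun e => f n e
      Comm := fun _ => Unit
      finite_comm := fun _ => inferInstance
      comm := fun _ _ _ => () },
    fun n => ⌊n * R (κ n)⌋₊, fun n => 1 / (κ n + 1), fun _ _ => le_rfl, fun n => by positivity,
    tendsto_one_div_add_atTop_nhds_zero_nat.comp hκlim, fun n e => ?_,
    tendsto_floor_rate (fun n => hRnn (κ n)) (hRlim.comp hκlim)⟩
  refine (isSecretKey_iff_nearUniform (K := fun ω => f n e (PIN.edgeVar ω e)) (fun _ _ => rfl)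
    (edgeSet_endpoints_nonempty e)).2 ⟨by positivity, by positivity, ?_⟩
  exact (hf n e).comp fun z => (fun _ => (), z)

/-! ### Achievability of the key rate -/

theorem lemma3 {m : ℕ} (hm : 2 ≤ m) (G : SimpleGraph (Fin m)) [Fintype G.edgeSet]
    (hG : G.IsTree) {𝒱 𝒵 : G.edgeSet → Type*}
    [∀ e, Countable (𝒱 e)] [∀ e, MeasurableSpace (𝒱 e)] [∀ e, DiscreteMeasurableSpace (𝒱 e)]
    [∀ e, Countable (𝒵 e)] [∀ e, MeasurableSpace (𝒵 e)] [∀ e, DiscreteMeasurableSpace (𝒵 e)]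
    (S : PIN G 𝒱 𝒵) :
    (∃ r s : Fin m, IsPendant G r s) ∧
    ∀ r s : Fin m, IsPendant G r s →
      (∀ (n : ℕ) (𝒦 : PairwiseKeys 𝒱 n) (L : ℕ) (hL : ∀ e, L ≤ 𝒦.len e) (ε σ : ℝ),
        (∀ e, 𝒦.IsPairSecret S e ε σ) →
        𝒦.IsGlobalSecret S hG r s hL
          (Fintype.card G.edgeSet * ε) (2 * Fintype.card G.edgeSet * σ)) ∧
      (∃ (𝒦 : ∀ n : ℕ, PairwiseKeys 𝒱 n) (L : ℕ → ℕ) (hL : ∀ n e, L n ≤ (𝒦 n).len e)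
          (ε σ : ℕ → ℝ),
        (∀ n, 0 < ε n ∧ 0 < σ n) ∧
        Tendsto (fun n => ε n + σ n) atTop (𝓝 0) ∧
        (∀ n e, (𝒦 n).IsPairSecret S e (ε n) (σ n)) ∧
        (∀ n, (𝒦 n).IsGlobalSecret S hG r s (hL n)
          (Fintype.card G.edgeSet * ε n) (2 * Fintype.card G.edgeSet * σ n)) ∧
        liminf (fun n : ℕ => (L n : ℝ≥0∞) / (n : ℝ≥0∞)) atTop = ⨅ e, S.edgeEntropy e) := by
  refine ⟨exists_isPendant hm hG, fun r s hrs => ⟨fun n 𝒦 L hL ε σ h =>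
    𝒦.isGlobalSecret S hG hrs hL h, ?_⟩⟩
  obtain ⟨𝒦, L, δ, hL, hδ, hlim, hsec, hrate⟩ := exists_pairwiseKeys S
  exact ⟨𝒦, L, hL, δ, δ, fun n => ⟨hδ n, hδ n⟩, by simpa using hlim.add hlim, hsec,
    fun n => (𝒦 n).isGlobalSecret S hG hrs (hL n) (hsec n), hrate.liminf_eq⟩
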